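/- Let $d\in\{2,3\}$, $\omega>0$, and let $\lambda,\mu\in\mathbb R$ satisfy $\mu>0$ and $2\mu+\lambda>0$. Put $k_p=\omega/\sqrt{2\mu+\lambda}$ and $k_s=\omega/\sqrt{\mu}$. Let $\Phi$ be the (outgoing) fundamental tensor of the Lamé operator $\Delta^*+\omega^2 I$, where $\Delta^*\mathbf u=\mu\Delta \mathbf u+(\lambda+\mu)\nabla\operatorname{div}\mathbf u$; explicitly, for $x\in\mathbb R^d\setminus\{0\}$, $$\Phi_{\alpha\beta}(x)=\Phi_1(|x|)\,\delta_{\alpha\beta}+\Phi_2(|x|)\,\frac{x_\alpha x_\beta}{|x|^2},\qquad 1\le\alpha,\beta\le d,$$ where, for $v>0$ and $d=2$, $$\Phi_1(v)=\tfrac{i}{4\mu}H^{(1)}_0(k_sv)-\tfrac{i}{4\omega^2v}\bigl[k_sH^{(1)}_1(k_sv)-k_pH^{(1)}_1(k_pv)\bigr],$$ $$\Phi_2(v)=\tfrac{i}{4\omega^2}\bigl[\tfrac{2k_s}{v}H^{(1)}_1(k_sv)-k_s^2H^{(1)}_0(k_sv)-\tfrac{2k_p}{v}H^{(1)}_1(k_pv)+k_p^2H^{(1)}_0(k_pv)\bigr]$$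 ($H^{(1)}_n$ is the Hankel function of the first kind of order $n$), and, for $v>0$ and $d=3$, $$\Phi_1(v)=\frac{k_s^2}{4\pi\omega^2}\frac{e^{ik_sv}}{v}+\frac1{4\pi\omega^2}\Bigl(\frac{ik_se^{ik_sv}-ik_pe^{ik_pv}}{v^2}-\frac{e^{ik_sv}-e^{ik_pv}}{v^3}\Bigr),$$ $$\Phi_2(v)=\frac1{4\pi\omega^2}\Bigl(-\frac{k_s^2e^{ik_sv}-k_p^2e^{ik_pv}}{v}-3\,\frac{ik_se^{ik_sv}-ik_pe^{ik_pv}}{v^2}+3\,\frac{e^{ik_sv}-e^{ik_pv}}{v^3}\Bigr).$$ Let $\rho>0$, $R>2\rho$, $G_R=\{x\in\mathbb R^d: |x_k|<R,\ k=1,\dots,d\}$, and let $\psi\in C^\infty([0,\infty);\mathbb R)$ satisfy $\psi(r)=1$ for $0\le r\le 2\rho$ and $\psi(r)=0$ for $r\ge R$. Put $K(x)=\Phi(x)\,\psi(|x|)$ on $G_R$, extended periodically with period $2R$ in each coordinate. Its components have the Fourier coefficients $$\widehat K_{\alpha\beta}(j)=\int_{G_R}K_{\alpha\beta}(x)\,\overline{\varphi_j(x)}\,dx,\qquad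 \varphi_j(x)=\frac{e^{i\pi j\cdot x/R}}{(2R)^{d/2}},\qquad j\in\mathbb Z^d.$$ Then every $K_{\alpha\beta}$ is integrable on $G_R$, and there is a constant $c>0$, depending only on $\omega,\lambda,\mu,R,\rho,d$ and the cutoff $\psi$, such that for all $\alpha,\beta\in\{1,\dots,d\}$ $$|\widehat K_{\alpha\beta}(j)|\le c\,|j|^{-2}\log|j|\qquad\text{for all } j\in\mathbb Z^d \text{ with } |j|>1,$$ and $|\widehat K_{\alpha\beta}(j)|\le c$ for all $j\in\mathbb Z^d$ with $|j|=1$. Here $|\cdot|$ is the Euclidean norm. -/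

import Mathlib

open scoped ContDiff

noncomputable section

namespace LameKernel

/-! ### Bessel and Hankel functions of integer order on the positive half-line -/

/-- The Bessel function of the first kind `J_n`, by its power series. -/
def besselJ (n : ℕ) (v : ℝ) : ℝ :=
  ∑' k : ℕ, (-1 : ℝ) ^ k / ((k.factorial : ℝ) * ((n + k).factorial : ℝ)) * (v / 2) ^ (2 * k + n)

/-- The Bessel function of the second kind `Y_n` (for `0 < v`), by its standard expansion
`Y_n(v) = (2/π) log(v/2) J_n(v) - (1/π) ∑_{k<n} ((n-k-1)!/k!) (v/2)^{2k-n}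
  - (1/π) ∑_{k≥0} (digamma(k+1) + digamma(n+k+1)) (-1)^k/(k!(n+k)!) (v/2)^{2k+n}`,
with `digamma(m+1) = H_m - γ`, where `H_m` is the `m`-th harmonic number and `γ` is Euler's
constant. -/
def besselY (n : ℕ) (v : ℝ) : ℝ :=
  2 / Real.pi * Real.log (v / 2) * besselJ n v
    - 1 / Real.pi * ∑ k ∈ Finset.range n,
        ((n - 1 - k).factorial : ℝ) / (k.factorial : ℝ) * (v / 2) ^ (2 * (k : ℤ) - (n : ℤ))
    - 1 / Real.pi * ∑' k : ℕ,
        ((harmonic k : ℝ) + (harmonic (n + k) : ℝ) - 2 * Real.eulerMascheroniConstant)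
          * ((-1 : ℝ) ^ k / ((k.factorial : ℝ) * ((n + k).factorial : ℝ)))
          * (v / 2) ^ (2 * k + n)

/-- The Hankel function of the first kind `H^{(1)}_n = J_n + i Y_n`. -/
def hankel1 (n : ℕ) (v : ℝ) : ℂ :=
  (besselJ n v : ℂ) + Complex.I * (besselY n v : ℂ)

/-! ### The fundamental tensor of the operator `μ Δ + (λ + μ) ∇ div + ω²` -/

/-- Longitudinal wave number, `k_p² = ω² / (2μ + λ)`. -/
def kp (lam mu omega : ℝ) : ℝ := omega / Real.sqrt (2 * mu + lam)

/-- Transverse wave number, `k_s² = ω² / μ`. -/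
def ks (mu omega : ℝ) : ℝ := omega / Real.sqrt mu

/-- Radial function `Φ₁` in dimension two. -/
def phi1Two (lam mu omega v : ℝ) : ℂ :=
  Complex.I / (4 * (mu : ℂ)) * hankel1 0 (ks mu omega * v)
    - Complex.I / (4 * (omega : ℂ) ^ 2 * (v : ℂ))
      * ((ks mu omega : ℂ) * hankel1 1 (ks mu omega * v)
          - (kp lam mu omega : ℂ) * hankel1 1 (kp lam mu omega * v))

/-- Radial function `Φ₂` in dimension two. -/
def phi2Two (lam mu omega v : ℝ) : ℂ :=
  Complex.I / (4 * (omega : ℂ) ^ 2)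
    * (2 * (ks mu omega : ℂ) / (v : ℂ) * hankel1 1 (ks mu omega * v)
        - (ks mu omega : ℂ) ^ 2 * hankel1 0 (ks mu omega * v)
        - 2 * (kp lam mu omega : ℂ) / (v : ℂ) * hankel1 1 (kp lam mu omega * v)
        + (kp lam mu omega : ℂ) ^ 2 * hankel1 0 (kp lam mu omega * v))

/-- The outgoing phase `e^{i k v}`. -/
def phase (k v : ℝ) : ℂ := Complex.exp (Complex.I * (k : ℂ) * (v : ℂ))

/-- Radial function `Φ₁` in dimension three. -/
def phi1Three (lam mu omega v : ℝ) : ℂ :=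
  (ks mu omega : ℂ) ^ 2 / (4 * (Real.pi : ℂ) * (omega : ℂ) ^ 2)
      * (phase (ks mu omega) v / (v : ℂ))
    + 1 / (4 * (Real.pi : ℂ) * (omega : ℂ) ^ 2)
      * ((Complex.I * (ks mu omega : ℂ) * phase (ks mu omega) v
            - Complex.I * (kp lam mu omega : ℂ) * phase (kp lam mu omega) v) / (v : ℂ) ^ 2
          - (phase (ks mu omega) v - phase (kp lam mu omega) v) / (v : ℂ) ^ 3)

/-- Radial function `Φ₂` in dimension three. -/
def phi2Three (lam mu omega v : ℝ) : ℂ :=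
  1 / (4 * (Real.pi : ℂ) * (omega : ℂ) ^ 2)
    * (-(((ks mu omega : ℂ) ^ 2 * phase (ks mu omega) v
            - (kp lam mu omega : ℂ) ^ 2 * phase (kp lam mu omega) v) / (v : ℂ))
        - 3 * ((Complex.I * (ks mu omega : ℂ) * phase (ks mu omega) v
            - Complex.I * (kp lam mu omega : ℂ) * phase (kp lam mu omega) v) / (v : ℂ) ^ 2)
        + 3 * ((phase (ks mu omega) v - phase (kp lam mu omega) v) / (v : ℂ) ^ 3))

/-- `Φ₁` in dimension `d` (only `d = 2, 3` are meaningful). -/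
def phi1 (d : ℕ) (lam mu omega v : ℝ) : ℂ :=
  if d = 2 then phi1Two lam mu omega v else phi1Three lam mu omega v

/-- `Φ₂` in dimension `d` (only `d = 2, 3` are meaningful). -/
def phi2 (d : ℕ) (lam mu omega v : ℝ) : ℂ :=
  if d = 2 then phi2Two lam mu omega v else phi2Three lam mu omega v

/-- The matrix `J(x) = xᵀ x / |x|²` (`x` a row vector). -/
def matJ (d : ℕ) (x : EuclideanSpace ℝ (Fin d)) : Matrix (Fin d) (Fin d) ℂ :=
  Matrix.of fun a b => ((x a * x b / ‖x‖ ^ 2 : ℝ) : ℂ)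

/-- The (outgoing) fundamental tensor `Φ(x) = Φ₁(|x|) I + Φ₂(|x|) J(x)`, `x ≠ 0`. -/
def Phi (d : ℕ) (lam mu omega : ℝ) (x : EuclideanSpace ℝ (Fin d)) : Matrix (Fin d) (Fin d) ℂ :=
  phi1 d lam mu omega ‖x‖ • (1 : Matrix (Fin d) (Fin d) ℂ) + phi2 d lam mu omega ‖x‖ • matJ d x

/-! ### Truncation and Fourier coefficients -/

/-- The truncated tensor `K(x) = Φ(x) ψ(|x|)`. -/
def K (d : ℕ) (lam mu omega : ℝ) (ψ : ℝ → ℝ) (x : EuclideanSpace ℝ (Fin d)) :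
    Matrix (Fin d) (Fin d) ℂ :=
  (ψ ‖x‖ : ℂ) • Phi d lam mu omega x

/-- The open cube `G_R = {x : |x_k| < R for all k}`, a period cell. -/
def cell (d : ℕ) (R : ℝ) : Set (EuclideanSpace ℝ (Fin d)) :=
  {x | ∀ k, |x k| < R}

/-- The exponentials `φ_j(x) = e^{iπ j·x/R} / (2R)^{d/2}`. -/
def expo (d : ℕ) (R : ℝ) (j : Fin d → ℤ) (x : EuclideanSpace ℝ (Fin d)) : ℂ :=
  Complex.exp (Complex.I * (Real.pi : ℂ) * ((∑ k, (j k : ℝ) * x k : ℝ) : ℂ) / (R : ℂ))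
    / (((2 * R) ^ ((d : ℝ) / 2) : ℝ) : ℂ)

/-- The Fourier coefficient `û(j) = ∫_{G_R} u(x) conj(φ_j(x)) dx` of the function that is `u` on
`G_R`, extended periodically with period `2R` in each coordinate. -/
def fourierCoef (d : ℕ) (R : ℝ) (u : EuclideanSpace ℝ (Fin d) → ℂ) (j : Fin d → ℤ) : ℂ :=
  ∫ x in cell d R, u x * (starRingEnd ℂ) (expo d R j x)

/-- The Euclidean length `|j|` of a multi-index. -/
def idxNorm (d : ℕ) (j : Fin d → ℤ) : ℝ := Real.sqrt (∑ k, (j k : ℝ) ^ 2)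

end LameKernel

end

/-! Half-period shifts turn the decay of a Fourier coefficient into the size of a second difference.
If `j k ≠ 0` and `h` is `R / j k` times the `k`-th unit vector, then `φ_j (x ± h) = -φ_j x`. As `K`
vanishes outside the ball of radius `R`, translation gives `4 |K̂(j)| ≤ (2R)^(-d/2) ∫ |K(x+h) +
K(x-h) - 2 K(x)| dx` over the whole space (`four_mul_norm_fourierCoef_le`).

With `n = d - 2`, `K` has size `(1 + |log |x||) / |x|^n` near the origin and second differences
`|h|² / |x|^d` where `2|h| ≤ |x|`; this is `KernelBound`. On `|x| < 2|h|` the size alone contributes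
`|h|² (1 + |log |h||)`; outside, integrating `|h|² / |x|^d` up to `|x| = 2R` gives `|h|² log
(1/|h|)` up to constants (`integral_second_difference_le`). Taking for `k` the largest coordinate
makes `|h|` comparable to `1/|j|`.

That `K` satisfies `KernelBound` rests on cancellation between the shear and pressure waves: the
strong poles in `Φ₁` and `Φ₂` drop out, leaving entire functions of `|x|²` times `log |x|` in the
plane and `1/|x|` in space, plus regular remainders (`exists_entire_phiTwo`,
`exists_entire_phiThree`). The class is stable under sums and `C²` factors, so the cutoff and the
matrix structure cause no loss. -/

namespace LameKernel

open Metric Set Real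

/-! ### Difference estimates for singular kernels -/

section Differences

variable {E : Type*} [NormedAddCommGroup E]

/-- A `C²` function and its first and second differences are controlled, on a compact set, by
the corresponding powers of the increment. -/
lemma exists_difference_bound [NormedSpace ℝ E] {F : E → ℂ} {U S : Set E} (hU : IsOpen U)
    (hF : ContDiffOn ℝ 2 F U) (hS : IsCompact S) (hSU : S ⊆ U) :
    ∃ M, 0 ≤ M ∧ ∀ x h, closedBall x ‖h‖ ⊆ S →
      ‖F x‖ ≤ M ∧ ‖F (x + h) - F x‖ ≤ M * ‖h‖ ∧
        ‖F (x + h) + F (x - h) - 2 * F x‖ ≤ M * ‖h‖ ^ 2 := by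
  have hF1 : ContDiffOn ℝ 1 (fderiv ℝ F) U := hF.fderiv_of_isOpen hU (by norm_num)
  have hF2 : ContinuousOn (fderiv ℝ (fderiv ℝ F)) U :=
    hF1.continuousOn_fderiv_of_isOpen hU le_rfl
  obtain ⟨M0, hM0⟩ := hS.exists_bound_of_continuousOn (hF.continuousOn.mono hSU)
  obtain ⟨M1, hM1⟩ := hS.exists_bound_of_continuousOn (hF1.continuousOn.mono hSU)
  obtain ⟨M2, hM2⟩ := hS.exists_bound_of_continuousOn (f := fderiv ℝ (fderiv ℝ F)) (hF2.mono hSU)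
  have dF : ∀ y ∈ U, DifferentiableAt ℝ F y := fun y hy =>
    (hF.contDiffAt (hU.mem_nhds hy)).differentiableAt (by norm_num)
  have dF1 : ∀ y ∈ U, DifferentiableAt ℝ (fderiv ℝ F) y := fun y hy =>
    (hF1.contDiffAt (hU.mem_nhds hy)).differentiableAt (by norm_num)
  refine ⟨max 0 (max M0 (max M1 M2)), le_max_left _ _, fun x h hx => ?_⟩
  have e0 : M0 ≤ max 0 (max M0 (max M1 M2)) := by simp
  have e1 : M1 ≤ max 0 (max M0 (max M1 M2)) := by simp
  have e2 : M2 ≤ max 0 (max M0 (max M1 M2)) := by simp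
  set M := max 0 (max M0 (max M1 M2))
  have hxS : x ∈ S := hx (mem_closedBall_self (norm_nonneg h))
  have hxh : x + h ∈ closedBall x ‖h‖ := by simp
  have hxh' : x - h ∈ closedBall x ‖h‖ := by simp
  have hxx : x ∈ closedBall x ‖h‖ := mem_closedBall_self (norm_nonneg h)
  have cvx := convex_closedBall x ‖h‖
  refine ⟨(hM0 x hxS).trans e0, ?_, ?_⟩
  · have := cvx.norm_image_sub_le_of_norm_fderiv_le (𝕜 := ℝ) (f := F) (C := M)
      (fun y hy => dF y (hSU (hx hy))) (fun y hy => (hM1 y (hx hy)).trans e1) hxx hxh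
    simpa using this
  -- The second difference is the increment of `y ↦ F (y + h) - F y` from `x - h` to `x`. Its
  -- derivative is itself a first difference of `fderiv ℝ F`, hence at most `M ‖h‖`.
  · have seg : ∀ y ∈ segment ℝ (x - h) x, y ∈ closedBall x ‖h‖ ∧ y + h ∈ closedBall x ‖h‖ := by
      intro y hy
      refine ⟨cvx.segment_subset hxh' hxx hy, ?_⟩
      have : y + h ∈ segment ℝ x (x + h) := by
        obtain ⟨a, b, ha, hb, hab, rfl⟩ := hy
        refine ⟨a, b, ha, hb, hab, ?_⟩
        have : h = a • h + b • h := by rw [← add_smul, hab, one_smul]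
        nth_rewrite 3 [this]
        module
      exact cvx.segment_subset hxx hxh this
    have der : ∀ y ∈ segment ℝ (x - h) x,
        HasFDerivWithinAt (fun y => F (y + h) - F y) (fderiv ℝ F (y + h) - fderiv ℝ F y)
          (segment ℝ (x - h) x) y := by
      intro y hy
      have h1 := (dF _ (hSU (hx (seg y hy).2))).hasFDerivAt
      have h2 := (dF _ (hSU (hx (seg y hy).1))).hasFDerivAt
      exact (((hasFDerivAt_comp_add_right h).2 h1).sub h2).hasFDerivWithinAt
    have bd : ∀ y ∈ segment ℝ (x - h) x, ‖fderiv ℝ F (y + h) - fderiv ℝ F y‖ ≤ M * ‖h‖ := by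
      intro y hy
      have := cvx.norm_image_sub_le_of_norm_fderiv_le (𝕜 := ℝ) (f := fderiv ℝ F) (C := M)
        (fun y hy => dF1 y (hSU (hx hy))) (fun y hy => (hM2 y (hx hy)).trans e2)
        (seg y hy).1 (seg y hy).2
      simpa using this
    have := (convex_segment (𝕜 := ℝ) (x - h) x).norm_image_sub_le_of_norm_hasFDerivWithin_le
      der bd (left_mem_segment ℝ _ _) (right_mem_segment ℝ _ _)
    simp only [sub_add_cancel, sub_sub_cancel] at this
    calc ‖F (x + h) + F (x - h) - 2 * F x‖ = ‖F (x + h) - F x - (F x - F (x - h))‖ := by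
          congr 1; ring
      _ ≤ M * ‖h‖ * ‖h‖ := this
      _ = M * ‖h‖ ^ 2 := by ring

/-- Differences of a `C²` function on the punctured space that is homogeneous of degree `-m` up
to radial constants. -/
lemma exists_difference_bound_of_homogeneous [NormedSpace ℝ E] [FiniteDimensional ℝ E] {m : ℕ} {F : E → ℂ}
    (hF : ContDiffOn ℝ 2 F {0}ᶜ) (c : ℝ → ℂ)
    (hom : ∀ r : ℝ, 0 < r → ∀ y, y ≠ 0 → F (r • y) = F y / (r : ℂ) ^ m + c r) :
    ∃ M, 0 ≤ M ∧ ∀ x, x ≠ 0 →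
      ‖F x‖ ≤ M / ‖x‖ ^ m + ‖c ‖x‖‖ ∧ ∀ h, 2 * ‖h‖ ≤ ‖x‖ →
        ‖F (x + h) - F x‖ ≤ M * (‖h‖ / ‖x‖ ^ (m + 1)) ∧
        ‖F (x + h) + F (x - h) - 2 * F x‖ ≤ M * (‖h‖ ^ 2 / ‖x‖ ^ (m + 2)) := by
  -- Rescaling by `‖x‖⁻¹` moves `x` to the unit sphere and makes the increment at most `1/2`, so the
  -- ball swept out stays in this annulus.
  have hS : IsCompact (closedBall (0 : E) 2 ∩ {y | 1 / 2 ≤ ‖y‖}) :=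
    (isCompact_closedBall _ _).inter_right (isClosed_le continuous_const continuous_norm)
  obtain ⟨M, hM, H⟩ := exists_difference_bound isOpen_compl_singleton hF hS (by
    rintro y ⟨-, hy⟩ rfl
    simp only [mem_ofPred_eq, norm_zero] at hy
    norm_num at hy)
  refine ⟨M, hM, fun x hx => ?_⟩
  set r := ‖x‖ with hr
  have r0 : 0 < r := norm_pos_iff.2 hx
  have key : ∀ h : E, 2 * ‖h‖ ≤ r → closedBall (r⁻¹ • x) ‖r⁻¹ • h‖ ⊆
      closedBall (0 : E) 2 ∩ {y | 1 / 2 ≤ ‖y‖} := by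
    intro h hh y hy
    have n1 : ‖r⁻¹ • x‖ = 1 := by
      rw [norm_smul, norm_inv, norm_of_nonneg r0.le, ← hr, inv_mul_cancel₀ r0.ne']
    have n2 : ‖r⁻¹ • h‖ ≤ 1 / 2 := by
      rw [norm_smul, norm_inv, norm_of_nonneg r0.le, inv_mul_le_iff₀ r0]; linarith
    rw [mem_closedBall, dist_eq_norm] at hy
    have t1 := norm_sub_norm_le (r⁻¹ • x) y
    have t2 := norm_sub_norm_le y (r⁻¹ • x)
    rw [norm_sub_rev] at t1
    constructor
    · rw [mem_closedBall_zero_iff]; linarith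
    · simp only [mem_ofPred_eq]; linarith
  have sc : ∀ y : E, y ≠ 0 → F y = F (r⁻¹ • y) / (r : ℂ) ^ m + c r := by
    intro y hy
    rw [← hom r r0 _ (smul_ne_zero (inv_ne_zero r0.ne') hy), smul_inv_smul₀ r0.ne']
  have nr : ‖(r : ℂ) ^ m‖ = r ^ m := by simp [abs_of_pos r0]
  have npos : 0 < r ^ m := by positivity
  refine ⟨?_, fun h hh => ?_⟩
  · have := (H (r⁻¹ • x) (r⁻¹ • 0) (key 0 (by simpa using r0.le))).1
    rw [sc x hx]
    refine (norm_add_le _ _).trans ?_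
    rw [norm_div, nr]
    gcongr
  · have := H (r⁻¹ • x) (r⁻¹ • h) (key h hh)
    rw [← smul_add, ← smul_sub, norm_smul, norm_inv, norm_of_nonneg r0.le] at this
    have ne : ∀ k : E, ‖k‖ = ‖h‖ → x + k ≠ 0 := by
      intro k hk h0
      have : x = -k := eq_neg_of_add_eq_zero_left h0
      have : r = ‖h‖ := by rw [hr, this, norm_neg, hk]
      linarith
    have e1 := sc x hx
    have e2 := sc (x + h) (ne h rfl)
    have e3 := sc (x - h) (by rw [sub_eq_add_neg]; exact ne (-h) (norm_neg h))
    constructor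
    · calc ‖F (x + h) - F x‖ = ‖(F (r⁻¹ • (x + h)) - F (r⁻¹ • x)) / (r : ℂ) ^ m‖ := by
            rw [e1, e2]; congr 1; ring
        _ = ‖F (r⁻¹ • (x + h)) - F (r⁻¹ • x)‖ / r ^ m := by rw [norm_div, nr]
        _ ≤ M * (r⁻¹ * ‖h‖) / r ^ m := by gcongr; exact this.2.1
        _ = M * (‖h‖ / r ^ (m + 1)) := by field_simp; ring
    · calc ‖F (x + h) + F (x - h) - 2 * F x‖
          = ‖(F (r⁻¹ • (x + h)) + F (r⁻¹ • (x - h)) - 2 * F (r⁻¹ • x)) / (r : ℂ) ^ m‖ := by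
            rw [e1, e2, e3]; congr 1; ring
        _ = ‖F (r⁻¹ • (x + h)) + F (r⁻¹ • (x - h)) - 2 * F (r⁻¹ • x)‖ / r ^ m := by
            rw [norm_div, nr]
        _ ≤ M * (r⁻¹ * ‖h‖) ^ 2 / r ^ m := by gcongr; exact this.2.2
        _ = M * (‖h‖ ^ 2 / r ^ (m + 2)) := by field_simp; ring

/-- `F` is continuous away from the origin and, on the ball of radius `D`, its size and its first
and second differences are those of a kernel with a singularity of order `-n` at the origin
(up to a logarithm in the size). -/
structure KernelBound (n : ℕ) (D : ℝ) (F : E → ℂ) : Prop where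
  continuousOn : ContinuousOn F {0}ᶜ
  bound : ∃ C, 0 ≤ C ∧ ∀ x, x ≠ 0 → ‖x‖ ≤ D →
    ‖F x‖ ≤ C * ((1 + |log ‖x‖|) / ‖x‖ ^ n) ∧ ∀ h, 2 * ‖h‖ ≤ ‖x‖ →
      ‖F (x + h) - F x‖ ≤ C * (‖h‖ / ‖x‖ ^ (n + 1)) ∧
      ‖F (x + h) + F (x - h) - 2 * F x‖ ≤ C * (‖h‖ ^ 2 / ‖x‖ ^ (n + 2))

namespace KernelBound

variable {n : ℕ} {D : ℝ} {F G : E → ℂ}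

lemma add (hF : KernelBound n D F) (hG : KernelBound n D G) :
    KernelBound n D (fun x => F x + G x) := by
  refine ⟨hF.continuousOn.add hG.continuousOn, ?_⟩
  obtain ⟨A, hA, HA⟩ := hF.bound
  obtain ⟨B, hB, HB⟩ := hG.bound
  refine ⟨A + B, by positivity, fun x hx hD => ?_⟩
  obtain ⟨a0, a⟩ := HA x hx hD
  obtain ⟨b0, b⟩ := HB x hx hD
  refine ⟨?_, fun h hh => ⟨?_, ?_⟩⟩
  · rw [add_mul]; exact norm_add_le_of_le a0 b0
  · have := norm_add_le_of_le (a h hh).1 (b h hh).1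
    rw [← add_mul] at this
    convert! this using 2; ring
  · have := norm_add_le_of_le (a h hh).2 (b h hh).2
    rw [← add_mul] at this
    convert! this using 2; ring

lemma congr (hF : KernelBound n D F) (h : ∀ x, x ≠ 0 → G x = F x) : KernelBound n D G := by
  refine ⟨hF.continuousOn.congr fun x hx => h x hx, ?_⟩
  obtain ⟨A, hA, HA⟩ := hF.bound
  refine ⟨A, hA, fun x hx hD => ?_⟩
  have r0 : 0 < ‖x‖ := norm_pos_iff.2 hx
  obtain ⟨a0, a⟩ := HA x hx hD
  refine ⟨by rwa [h x hx], fun k hk => ?_⟩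
  have ne : ∀ l : E, ‖l‖ = ‖k‖ → x + l ≠ 0 := by
    intro l hl h0
    have : x = -l := eq_neg_of_add_eq_zero_left h0
    have : ‖x‖ = ‖k‖ := by rw [this, norm_neg, hl]
    linarith
  rw [h x hx, h _ (ne k rfl),
    h (x - k) (by rw [sub_eq_add_neg]; exact ne (-k) (norm_neg k))]
  exact a k hk

/-- On the ball of radius `D` one has `1 ≤ |D| / ‖x‖`, so a milder singularity counts as a stronger
one. This puts all the three-dimensional pieces into one class. -/
lemma succ (hF : KernelBound n D F) : KernelBound (n + 1) D F := by
  refine ⟨hF.continuousOn, ?_⟩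
  obtain ⟨A, hA, HA⟩ := hF.bound
  refine ⟨A * |D|, by positivity, fun x hx hD => ?_⟩
  have r0 : 0 < ‖x‖ := norm_pos_iff.2 hx
  have hD' : ‖x‖ ≤ |D| := hD.trans (le_abs_self D)
  obtain ⟨a0, a⟩ := HA x hx hD
  have aux : ∀ (t : ℝ) (k : ℕ), 0 ≤ t → A * (t / ‖x‖ ^ k) ≤ A * |D| * (t / ‖x‖ ^ (k + 1)) := by
    intro t k ht
    rw [mul_assoc]
    gcongr
    calc t / ‖x‖ ^ k = ‖x‖ * (t / ‖x‖ ^ (k + 1)) := by field_simp; ring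
      _ ≤ |D| * (t / ‖x‖ ^ (k + 1)) := by gcongr
  exact ⟨a0.trans (aux _ _ (by positivity)), fun h hh =>
    ⟨(a h hh).1.trans (aux _ _ (by positivity)), (a h hh).2.trans (aux _ _ (by positivity))⟩⟩

/-- A discrete Leibniz rule. Each difference falling on `χ` instead of `F` gains a power of `‖x‖`,
which absorbs the logarithm in the size of `F` since `r (1 + |log r|)` is bounded for `r ≤ D`. Hence
the difference bounds stay free of logarithms. -/
lemma mul_contDiff [NormedSpace ℝ E] [FiniteDimensional ℝ E] (hF : KernelBound n D F) {χ : E → ℂ}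
    (hχ : ContDiff ℝ 2 χ) : KernelBound n D (fun x => χ x * F x) := by
  refine ⟨hχ.continuous.continuousOn.mul hF.continuousOn, ?_⟩
  obtain ⟨A, hA, HA⟩ := hF.bound
  -- Radius `2 * D` leaves room for `x ± h` with `‖x‖ ≤ D` and `2‖h‖ ≤ ‖x‖`.
  obtain ⟨B, hB, HB⟩ := exists_difference_bound isOpen_univ hχ.contDiffOn
    (isCompact_closedBall (0 : E) (2 * D)) (subset_univ _)
  set L := 1 + |D| + D ^ 2 with hL
  refine ⟨A * B * (1 + L + 2 * |D| + |D| * L), by positivity, fun x hx hD => ?_⟩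
  have r0 : 0 < ‖x‖ := norm_pos_iff.2 hx
  have hD' : ‖x‖ ≤ |D| := hD.trans (le_abs_self D)
  have hB' : ∀ h : E, 2 * ‖h‖ ≤ ‖x‖ → closedBall x ‖h‖ ⊆ closedBall 0 (2 * D) := by
    intro h hh y hy
    rw [mem_closedBall, dist_eq_norm] at hy
    have := norm_sub_norm_le y x
    rw [mem_closedBall_zero_iff]; linarith
  obtain ⟨a0, a⟩ := HA x hx hD
  have b0 := (HB x 0 (hB' 0 (by simp))).1
  set r := ‖x‖ with hr
  have hlog : r * (1 + |log r|) ≤ L := by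
    have h1 := log_le_sub_one_of_pos r0
    have h2 := log_le_sub_one_of_pos (inv_pos.2 r0)
    rw [log_inv] at h2
    have h3 : |log r| ≤ r + r⁻¹ := by
      rw [abs_le]; constructor <;> linarith [inv_pos.2 r0]
    calc r * (1 + |log r|) ≤ r * (1 + (r + r⁻¹)) := by gcongr
      _ = 1 + r + r ^ 2 := by field_simp; ring
      _ ≤ 1 + |D| + |D| ^ 2 := by gcongr
      _ = L := by rw [sq_abs]
  have hlog0 : 0 ≤ 1 + |log r| := by positivity
  have L0 : 0 ≤ L := by positivity
  refine ⟨?_, fun h hh => ?_⟩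
  · rw [norm_mul]
    calc ‖χ x‖ * ‖F x‖ ≤ B * (A * ((1 + |log r|) / r ^ n)) := by gcongr
      _ = A * B * 1 * ((1 + |log r|) / r ^ n) := by ring
      _ ≤ _ := by
        gcongr
        have : 0 ≤ L + 2 * |D| + |D| * L := by positivity
        linarith
  · obtain ⟨a1, a2⟩ := a h hh
    obtain ⟨-, b1, b2⟩ := HB x h (hB' h hh)
    have a1' := (a (-h) (by simpa using hh)).1
    have b1' := (HB x (-h) (by simpa using hB' h hh)).2.1
    rw [norm_neg, ← sub_eq_add_neg] at a1' b1'
    have hrD : ‖x + h‖ + ‖h‖ ≤ 2 * D := by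
      have := norm_add_le x h
      linarith
    have bh : ‖χ (x + h)‖ ≤ B := by
      refine (HB (x + h) 0 ?_).1
      intro y hy
      rw [norm_zero, mem_closedBall, dist_le_zero] at hy
      rw [hy, mem_closedBall_zero_iff]
      linarith [norm_nonneg h]
    constructor
    · calc ‖χ (x + h) * F (x + h) - χ x * F x‖
          = ‖χ (x + h) * (F (x + h) - F x) + (χ (x + h) - χ x) * F x‖ := by congr 1; ring
        _ ≤ B * (A * (‖h‖ / r ^ (n + 1))) + B * ‖h‖ * (A * ((1 + |log r|) / r ^ n)) := by
          refine norm_add_le_of_le ?_ ?_ <;> rw [norm_mul] <;> gcongr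
        _ = A * B * (1 + r * (1 + |log r|)) * (‖h‖ / r ^ (n + 1)) := by field_simp; ring
        _ ≤ _ := by
          gcongr ?_ * _
          refine mul_le_mul_of_nonneg_left ?_ (by positivity)
          have : 0 ≤ 2 * |D| + |D| * L := by positivity
          linarith
    · calc ‖χ (x + h) * F (x + h) + χ (x - h) * F (x - h) - 2 * (χ x * F x)‖
          = ‖(χ (x + h) - χ x) * (F (x + h) - F x) + (χ (x - h) - χ x) * (F (x - h) - F x)
              + (χ x * (F (x + h) + F (x - h) - 2 * F x)
                + (χ (x + h) + χ (x - h) - 2 * χ x) * F x)‖ := by congr 1; ring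
        _ ≤ B * ‖h‖ * (A * (‖h‖ / r ^ (n + 1))) + B * ‖h‖ * (A * (‖h‖ / r ^ (n + 1)))
              + (B * (A * (‖h‖ ^ 2 / r ^ (n + 2)))
                + B * ‖h‖ ^ 2 * (A * ((1 + |log r|) / r ^ n))) := by
          refine norm_add_le_of_le (norm_add_le_of_le ?_ ?_) (norm_add_le_of_le ?_ ?_) <;>
            rw [norm_mul] <;> gcongr
        _ = A * B * (1 + 2 * r + r * (r * (1 + |log r|))) * (‖h‖ ^ 2 / r ^ (n + 2)) := by
          field_simp; ring
        _ ≤ _ := by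
          gcongr ?_ * _
          have : r * (r * (1 + |log r|)) ≤ |D| * L := by gcongr
          refine mul_le_mul_of_nonneg_left ?_ (by positivity)
          linarith

lemma of_homogeneous [NormedSpace ℝ E] [FiniteDimensional ℝ E] (hF : ContDiffOn ℝ 2 F {0}ᶜ)
    (hom : ∀ r : ℝ, 0 < r → ∀ y, y ≠ 0 → F (r • y) = F y / (r : ℂ) ^ n) : KernelBound n D F := by
  refine ⟨hF.continuousOn, ?_⟩
  obtain ⟨M, hM, H⟩ := exists_difference_bound_of_homogeneous hF 0 (fun r hr y hy => by
    simpa using hom r hr y hy)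
  refine ⟨M, hM, fun x hx _ => ⟨(H x hx).1.trans ?_, (H x hx).2⟩⟩
  have r0 : 0 < ‖x‖ := norm_pos_iff.2 hx
  simp only [Pi.zero_apply, norm_zero, add_zero]
  rw [← mul_div_assoc]
  gcongr
  exact le_mul_of_one_le_right hM (by simp)

lemma one [NormedSpace ℝ E] [FiniteDimensional ℝ E] : KernelBound 0 D (fun _ : E => (1 : ℂ)) :=
  of_homogeneous contDiffOn_const (by simp)

lemma _root_.LameKernel.contDiffOn_log_norm {E : Type*} [NormedAddCommGroup E]
    [InnerProductSpace ℝ E] :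
    ContDiffOn ℝ 2 (fun x : E => ((log ‖x‖ : ℝ) : ℂ)) {0}ᶜ := fun x hx =>
  (Complex.ofRealCLM.contDiff.contDiffAt.comp x
    ((contDiffAt_norm ℝ hx).log (norm_ne_zero_iff.2 hx))).contDiffWithinAt

/-- Dilation by `r` only adds the constant `log r`, which differences do not see; so the logarithm
enters the size bound alone. -/
lemma log_norm {E : Type*} [NormedAddCommGroup E] [InnerProductSpace ℝ E] [FiniteDimensional ℝ E] :
    KernelBound 0 D (fun x : E => ((log ‖x‖ : ℝ) : ℂ)) := by
  refine ⟨contDiffOn_log_norm.continuousOn, ?_⟩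
  obtain ⟨M, hM, H⟩ := exists_difference_bound_of_homogeneous (m := 0) (E := E)
    contDiffOn_log_norm (fun r => ((log r : ℝ) : ℂ)) (fun r hr y hy => by
      rw [norm_smul, norm_of_nonneg hr.le, log_mul hr.ne' (norm_ne_zero_iff.2 hy)]
      push_cast; ring)
  refine ⟨M + 1, by positivity, fun x hx _ => ?_⟩
  have r0 : 0 < ‖x‖ := norm_pos_iff.2 hx
  refine ⟨?_, fun h hh => ⟨((H x hx).2 h hh).1.trans ?_, ((H x hx).2 h hh).2.trans ?_⟩⟩
  · rw [Complex.norm_real, norm_eq_abs, pow_zero, div_one]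
    nlinarith [abs_nonneg (log ‖x‖), mul_nonneg hM (abs_nonneg (log ‖x‖))]
  · gcongr; linarith
  · gcongr; linarith

lemma of_contDiff [NormedSpace ℝ E] [FiniteDimensional ℝ E] {χ : E → ℂ} (hχ : ContDiff ℝ 2 χ) :
    KernelBound 0 D χ := by
  simpa using one.mul_contDiff hχ

end KernelBound

end Differences
end LameKernel

namespace LameKernel

open Metric Set Real

/-! ### The `L¹` norm of the second difference -/

section SecondDifference

open MeasureTheory Module

variable {E : Type*} [NormedAddCommGroup E] [NormedSpace ℝ E] [FiniteDimensional ℝ E]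
  [MeasurableSpace E] [BorelSpace E] (μ : Measure E) [μ.IsAddHaarMeasure] {n : ℕ} {D : ℝ}
  {F : E → ℂ}

lemma integrableOn_annulus_fun_norm (hdim : finrank ℝ E = n + 2) {a b : ℝ} (ha : 0 ≤ a) {g : ℝ → ℝ}
    (hg : IntegrableOn (fun r => r ^ (n + 1) * g r) (Ioo a b)) :
    IntegrableOn (fun x : E => g ‖x‖) {x | ‖x‖ ∈ Ioo a b} μ ∧
      ∫ x in {x : E | ‖x‖ ∈ Ioo a b}, g ‖x‖ ∂μ =
        (finrank ℝ E * μ.real (ball 0 1)) * ∫ r in Ioo a b, r ^ (n + 1) * g r := by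
  have : Nontrivial E := nontrivial_of_finrank_pos (R := ℝ) (by omega)
  have hm : MeasurableSet {x : E | ‖x‖ ∈ Ioo a b} := measurable_norm measurableSet_Ioo
  have e : ({x : E | ‖x‖ ∈ Ioo a b}).indicator (fun x => g ‖x‖) =
      fun x => (Ioo a b).indicator g ‖x‖ := rfl
  have e1 : finrank ℝ E - 1 = n + 1 := by omega
  have e2 : (fun r : ℝ => r ^ (finrank ℝ E - 1) • (Ioo a b).indicator g r) =
      (Ioo a b).indicator (fun r => r ^ (n + 1) * g r) := by
    ext r
    by_cases hr : r ∈ Ioo a b <;> simp [hr, e1]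
  have sub : Ioo a b ∩ Ioi 0 = Ioo a b := inter_eq_left.2 fun r hr => ha.trans_lt hr.1
  constructor
  · rw [← integrable_indicator_iff hm, e, integrable_fun_norm_addHaar, e2]
    exact ((integrable_indicator_iff measurableSet_Ioo).2 hg).integrableOn
  · rw [← integral_indicator hm, e, integral_fun_norm_addHaar, e2,
      setIntegral_indicator measurableSet_Ioo, inter_comm, sub, nsmul_eq_mul, smul_eq_mul]
    ring

/-- From `log (s / r) ≤ s / r - 1`, `|log r|` exceeds `|log s|` by at most `s / r`, and the factor
`r` turns this excess into `s`. -/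
lemma mul_one_add_abs_log_le {r s : ℝ} (hr : 0 < r) (hs : r ≤ s) :
    r * (1 + |log r|) ≤ s * (3 + |log s|) := by
  have s0 : 0 < s := hr.trans_le hs
  have h1 := log_le_sub_one_of_pos (div_pos s0 hr)
  rw [log_div s0.ne' hr.ne'] at h1
  have h2 : log r ≤ log s := log_le_log hr hs
  have h3 : |log r| ≤ |log s| + s / r := by
    rw [abs_le]
    constructor <;> linarith [neg_abs_le (log s), le_abs_self (log s), div_pos s0 hr]
  calc r * (1 + |log r|) ≤ r * (1 + (|log s| + s / r)) := by gcongr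
    _ = r * (1 + |log s|) + s := by field_simp; ring
    _ ≤ s * (1 + |log s|) + s := by gcongr
    _ ≤ s * (3 + |log s|) := by nlinarith

lemma integrableOn_mul_log {C s : ℝ} :
    IntegrableOn (fun r : ℝ => r ^ (n + 1) * (C * ((1 + |log r|) / r ^ n))) (Ioo 0 s) ∧
    (0 ≤ C → 0 < s → ∫ r in Ioo 0 s, r ^ (n + 1) * (C * ((1 + |log r|) / r ^ n)) ≤
      C * (s ^ 2 * (3 + |log s|))) := by
  have hb : ∀ r ∈ Ioo 0 s, ‖r ^ (n + 1) * (C * ((1 + |log r|) / r ^ n))‖ ≤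
      |C| * (s * (3 + |log s|)) := by
    intro r hr
    have r0 := hr.1
    have : r ^ (n + 1) * (C * ((1 + |log r|) / r ^ n)) = C * (r * (1 + |log r|)) := by
      field_simp; ring
    rw [this, norm_mul, norm_eq_abs C, norm_of_nonneg (by positivity)]
    exact mul_le_mul_of_nonneg_left (mul_one_add_abs_log_le r0 hr.2.le) (abs_nonneg C)
  constructor
  · refine Measure.integrableOn_of_bounded (M := |C| * (s * (3 + |log s|))) (by simp) ?_ ?_
    · apply Measurable.aestronglyMeasurable
      fun_prop
    · exact (ae_restrict_iff' measurableSet_Ioo).2 (Filter.Eventually.of_forall hb)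
  · intro hC hs
    refine (le_norm_self _).trans
      ((norm_setIntegral_le_of_norm_le_const (by simp) hb).trans_eq ?_)
    rw [abs_of_nonneg hC]
    simp [hs.le]
    ring

namespace KernelBound

lemma aestronglyMeasurable [Nontrivial E] (hF : KernelBound n D F) :
    AEStronglyMeasurable F μ := by
  rw [← restrict_compl_singleton (μ := μ) 0]
  exact hF.continuousOn.aestronglyMeasurable (measurableSet_singleton _).compl

/-- In polar coordinates the Jacobian `r ^ (n + 1)` beats the singularity `r ^ (-n)` and leaves `r
(1 + |log r|)`. -/
lemma integral_ball_le (hF : KernelBound n D F) (hdim : finrank ℝ E = n + 2) :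
    ∃ C, 0 ≤ C ∧ ∀ s, 0 < s → s ≤ D → IntegrableOn F (ball 0 s) μ ∧
      ∫ x in ball 0 s, ‖F x‖ ∂μ ≤ C * (s ^ 2 * (3 + |log s|)) := by
  have : Nontrivial E := nontrivial_of_finrank_pos (R := ℝ) (by omega)
  obtain ⟨C, hC, H⟩ := hF.bound
  refine ⟨(finrank ℝ E * μ.real (ball 0 1)) * C, by positivity, fun s hs hsD => ?_⟩
  have hae : (ball (0 : E) s : Set E) =ᵐ[μ] {x : E | ‖x‖ ∈ Ioo 0 s} := by
    have : {x : E | ‖x‖ ∈ Ioo 0 s} = ball 0 s \ {0} := by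
      ext x; simp [and_comm]
    rw [this]
    exact (sdiff_null_ae_eq_self (by simp)).symm
  obtain ⟨h1, h2⟩ := integrableOn_annulus_fun_norm μ hdim le_rfl
    (integrableOn_mul_log (n := n) (C := C) (s := s)).1
  have hm : MeasurableSet {x : E | ‖x‖ ∈ Ioo 0 s} := measurable_norm measurableSet_Ioo
  have hle : ∀ x ∈ {x : E | ‖x‖ ∈ Ioo 0 s}, ‖F x‖ ≤ C * ((1 + |log ‖x‖|) / ‖x‖ ^ n) :=
    fun x hx => (H x (norm_pos_iff.1 hx.1) (hx.2.le.trans hsD)).1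
  have hint : IntegrableOn F {x : E | ‖x‖ ∈ Ioo 0 s} μ :=
    Integrable.mono' h1 (hF.aestronglyMeasurable μ).restrict
      ((ae_restrict_iff' hm).2 (Filter.Eventually.of_forall hle))
  refine ⟨hint.congr_set_ae hae, ?_⟩
  rw [setIntegral_congr_set hae]
  refine (setIntegral_mono_on hint.norm h1 hm hle).trans ?_
  rw [h2, mul_assoc _ C]
  exact mul_le_mul_of_nonneg_left ((integrableOn_mul_log (n := n)).2 hC hs) (by positivity)

lemma integrable (hF : KernelBound n D F) (hdim : finrank ℝ E = n + 2) (hD : 0 < D)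
    (h0 : ∀ x, D ≤ ‖x‖ → F x = 0) : Integrable F μ := by
  obtain ⟨C, -, H⟩ := hF.integral_ball_le μ hdim
  refine (integrableOn_iff_integrable_of_support_subset ?_).1 (H D hD le_rfl).1
  intro x hx
  rw [mem_ball_zero_iff]
  by_contra! h
  exact hx (h0 x h)

/-- Split at `‖x‖ = 2‖h‖`: inside, only the size of `F` is used; outside, the pointwise
second-difference bound is integrated. The radius `3 * R` in the hypothesis covers the balls of
radius `3‖h‖` used in the inner part. -/
lemma integral_second_difference_le {R : ℝ} (hR : 0 < R) (hF : KernelBound n (3 * R) F)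
    (hdim : finrank ℝ E = n + 2) (h0 : ∀ x, R ≤ ‖x‖ → F x = 0) :
    ∃ C, 0 ≤ C ∧ ∀ (h : E) (m : ℝ), 1 ≤ m → ‖h‖ = R / m →
      ∫ x, ‖F (x + h) + F (x - h) - 2 * F x‖ ∂μ ≤ C * ((1 + log m) / m ^ 2) := by
  have hint : Integrable F μ := hF.integrable μ hdim (by positivity)
    fun x hx => h0 x (by linarith)
  obtain ⟨C, hC, H⟩ := hF.bound
  obtain ⟨B, hB, HB⟩ := hF.integral_ball_le μ hdim
  set A := (finrank ℝ E * μ.real (ball 0 1)) with hA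
  have A0 : 0 ≤ A := by positivity
  -- `36 = 4 · 3²`: four copies of `F` in the second difference, each integrated over a ball of
  -- radius `3‖h‖`.
  refine ⟨36 * B * R ^ 2 * (3 + |log (3 * R)|) + C * A * R ^ 2, by positivity, ?_⟩
  intro h m hm hh
  have m0 : 0 < m := by linarith
  have lm : 0 ≤ log m := log_nonneg hm
  set ε := ‖h‖ with hε
  have ε0 : 0 < ε := by rw [hh]; positivity
  have εR : ε ≤ R := by rw [hh]; exact div_le_self hR.le hm
  have i1 : Integrable (fun x => F (x + h)) μ := hint.comp_add_right h
  have i2 : Integrable (fun x => F (x - h)) μ := hint.comp_sub_right h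
  have i3 : Integrable (fun x => F (x + h) + F (x - h) - 2 * F x) μ :=
    (i1.add i2).sub (hint.const_mul 2)
  rw [← integral_add_compl (measurableSet_ball (x := (0 : E)) (ε := 2 * ε)) i3.norm]
  have shift : ∀ k : E, ‖k‖ ≤ ε →
      ∫ x in ball 0 (2 * ε), ‖F (x + k)‖ ∂μ ≤ ∫ x in ball 0 (3 * ε), ‖F x‖ ∂μ := by
    intro k hk
    rw [← integral_indicator measurableSet_ball, ← integral_indicator measurableSet_ball,
      ← integral_add_right_eq_self ((ball 0 (3 * ε)).indicator fun x => ‖F x‖) k]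
    refine integral_mono ((hint.comp_add_right k).norm.indicator measurableSet_ball)
      ((hint.norm.indicator measurableSet_ball).comp_add_right k) fun x => ?_
    by_cases hx : x ∈ ball 0 (2 * ε)
    · have hx' : x + k ∈ ball 0 (3 * ε) := by
        rw [mem_ball_zero_iff] at hx ⊢
        linarith [norm_add_le x k]
      simp only [indicator_of_mem hx, indicator_of_mem hx', le_refl]
    · simp only [indicator_of_notMem hx]
      exact indicator_nonneg (fun _ _ => norm_nonneg _) _
  have near : ∫ x in ball 0 (2 * ε), ‖F (x + h) + F (x - h) - 2 * F x‖ ∂μ ≤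
      4 * ∫ x in ball 0 (3 * ε), ‖F x‖ ∂μ := by
    have s1 := shift h le_rfl
    have s2 := shift (-h) (norm_neg h).le
    have s3 := shift 0 (by simpa using ε0.le)
    simp only [← sub_eq_add_neg, add_zero] at s2 s3
    calc ∫ x in ball 0 (2 * ε), ‖F (x + h) + F (x - h) - 2 * F x‖ ∂μ
        ≤ ∫ x in ball 0 (2 * ε), (‖F (x + h)‖ + ‖F (x - h)‖ + 2 * ‖F x‖) ∂μ := by
          refine integral_mono i3.norm.integrableOn
            ((i1.norm.add i2.norm).add (hint.norm.const_mul 2)).integrableOn fun x => ?_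
          refine (norm_sub_le _ _).trans (add_le_add (norm_add_le _ _) ?_)
          rw [norm_mul, Complex.norm_ofNat]
      _ = (∫ x in ball 0 (2 * ε), ‖F (x + h)‖ ∂μ) + (∫ x in ball 0 (2 * ε), ‖F (x - h)‖ ∂μ)
            + 2 * ∫ x in ball 0 (2 * ε), ‖F x‖ ∂μ := by
          rw [← integral_const_mul, ← integral_add i1.norm.integrableOn i2.norm.integrableOn,
            ← integral_add (f := fun x => ‖F (x + h)‖ + ‖F (x - h)‖)
              (i1.norm.add i2.norm).integrableOn (hint.norm.const_mul 2).integrableOn]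
      _ ≤ _ := by linarith
  have far : ∫ x in (ball 0 (2 * ε))ᶜ, ‖F (x + h) + F (x - h) - 2 * F x‖ ∂μ ≤
      C * ε ^ 2 * (A * (1 + log m)) := by
    have heq : ∀ r ∈ Ioo ε (2 * R), r ^ (n + 1) * (C * (ε ^ 2 / r ^ (n + 2))) =
        C * ε ^ 2 * r⁻¹ := by
      intro r hr
      have : 0 < r := ε0.trans hr.1
      field_simp
      ring
    -- The annulus starts at `ε`, not `2ε`, so that the open interval contains the sphere `‖x‖ =
    -- 2ε`. It stops at `2R` because `x` and `x ± h` all have norm at least `R` beyond that.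
    have hgi : IntegrableOn (fun r : ℝ => C * ε ^ 2 * r⁻¹) (Ioo ε (2 * R)) := by
      refine (ContinuousOn.integrableOn_Icc ?_).mono_set Ioo_subset_Icc_self
      exact continuousOn_const.mul (continuousOn_inv₀.mono fun r hr => (ε0.trans_le hr.1).ne')
    obtain ⟨g1, g2⟩ := integrableOn_annulus_fun_norm (n := n) (E := E) μ hdim ε0.le
      (g := fun r => C * (ε ^ 2 / r ^ (n + 2)))
      ((integrableOn_congr_fun heq measurableSet_Ioo).2 hgi)
    have hval : ∫ r in Ioo ε (2 * R), r ^ (n + 1) * (C * (ε ^ 2 / r ^ (n + 2))) ≤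
        C * ε ^ 2 * (1 + log m) := by
      rw [setIntegral_congr_fun measurableSet_Ioo heq, integral_const_mul,
        ← integral_Ioc_eq_integral_Ioo, ← intervalIntegral.integral_of_le (by linarith),
        integral_inv_of_pos ε0 (by positivity)]
      refine mul_le_mul_of_nonneg_left ?_ (by positivity)
      have : 2 * R / ε = 2 * m := by rw [hh]; field_simp
      rw [this, log_mul two_ne_zero m0.ne']
      linarith [log_two_lt_d9]
    have hm' : MeasurableSet {x : E | ‖x‖ ∈ Ioo ε (2 * R)} := measurable_norm measurableSet_Ioo
    calc ∫ x in (ball 0 (2 * ε))ᶜ, ‖F (x + h) + F (x - h) - 2 * F x‖ ∂μ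
        ≤ ∫ x in {x : E | ‖x‖ ∈ Ioo ε (2 * R)}, C * (ε ^ 2 / ‖x‖ ^ (n + 2)) ∂μ := by
          rw [← integral_indicator measurableSet_ball.compl, ← integral_indicator hm']
          refine integral_mono (i3.norm.indicator measurableSet_ball.compl)
            ((integrable_indicator_iff hm').2 g1) fun x => ?_
          have nn : 0 ≤ {x : E | ‖x‖ ∈ Ioo ε (2 * R)}.indicator
              (fun x => C * (ε ^ 2 / ‖x‖ ^ (n + 2))) x :=
            indicator_nonneg (fun _ _ => by positivity) _
          by_cases hx : x ∈ (ball (0 : E) (2 * ε))ᶜ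
          · rw [indicator_of_mem hx]
            rw [mem_compl_iff, mem_ball_zero_iff, not_lt] at hx
            have x0 : 0 < ‖x‖ := by linarith
            by_cases hxR : ‖x‖ < 2 * R
            · rw [indicator_of_mem (show x ∈ {x : E | ‖x‖ ∈ Ioo ε (2 * R)} from
                ⟨by linarith, hxR⟩)]
              exact ((H x (norm_pos_iff.1 x0) (by linarith)).2 h hx).2
            · have t1 := norm_sub_norm_le x h
              have t2 := norm_sub_norm_le x (-h)
              rw [norm_neg, sub_neg_eq_add] at t2
              rw [h0 x (by linarith), h0 (x + h) (by linarith), h0 (x - h) (by linarith)]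
              simpa using nn
          · rwa [indicator_of_notMem hx]
      _ ≤ A * (C * ε ^ 2 * (1 + log m)) := by
          rw [g2]
          exact mul_le_mul_of_nonneg_left hval A0
      _ = _ := by ring
  have hlog : |log (3 * ε)| ≤ |log (3 * R)| + log m := by
    have : log (3 * ε) = log (3 * R) - log m := by
      rw [hh, ← log_div (by positivity) (by positivity)]; ring_nf
    rw [this]
    exact (abs_sub _ _).trans (by rw [abs_of_nonneg lm])
  have b3 := (HB (3 * ε) (by positivity) (by linarith)).2
  calc _ ≤ 4 * (B * ((3 * ε) ^ 2 * (3 + (|log (3 * R)| + log m)))) + C * ε ^ 2 * (A * (1 + log m)) := by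
        refine add_le_add (near.trans ?_) far
        gcongr
        exact b3.trans (by gcongr)
    _ ≤ 36 * B * ε ^ 2 * ((3 + |log (3 * R)|) * (1 + log m)) + C * ε ^ 2 * (A * (1 + log m)) := by
        have : 3 + (|log (3 * R)| + log m) ≤ (3 + |log (3 * R)|) * (1 + log m) := by
          nlinarith [abs_nonneg (log (3 * R)), mul_nonneg (abs_nonneg (log (3 * R))) lm]
        gcongr ?_ + _
        calc _ = 36 * B * ε ^ 2 * (3 + (|log (3 * R)| + log m)) := by ring
          _ ≤ _ := by gcongr
    _ = _ := by rw [hh]; field_simp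

end KernelBound
end SecondDifference
end LameKernel

namespace LameKernel

open Real

/-! ### Expansions of the radial functions at the origin -/

section EntireExpansions

lemma exists_entire_mul {g : ℂ → ℂ} (hg : Differentiable ℂ g) (h0 : g 0 = 0) :
    ∃ q : ℂ → ℂ, Differentiable ℂ q ∧ ∀ z, g z = z * q z := by
  refine ⟨dslope g 0, ?_, fun z => ?_⟩
  · rw [← differentiableOn_univ] at hg ⊢
    exact (Complex.differentiableOn_dslope Filter.univ_mem).2 hg
  · simpa [h0] using (sub_smul_dslope g 0 z).symm

lemma differentiable_tsum_mul_pow {a : ℕ → ℂ} {C M : ℝ}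
    (ha : ∀ k, ‖a k‖ ≤ C * M ^ k / (k.factorial : ℝ)) :
    Differentiable ℂ (fun z => ∑' k, a k * z ^ k) := by
  intro z
  have hs : Summable fun k : ℕ => C * ((M * (‖z‖ + 1)) ^ k / (k.factorial : ℝ)) :=
    (Real.summable_pow_div_factorial _).mul_left C
  refine (Complex.differentiableOn_tsum_of_summable_norm hs
    (U := Metric.ball 0 (‖z‖ + 1)) (fun k => by fun_prop) Metric.isOpen_ball
    fun k w hw => ?_).differentiableAt (Metric.isOpen_ball.mem_nhds (by simp))
  rw [mem_ball_zero_iff] at hw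
  rw [norm_mul, norm_pow]
  have h0 : 0 ≤ C * M ^ k / (k.factorial : ℝ) := (norm_nonneg _).trans (ha k)
  calc ‖a k‖ * ‖w‖ ^ k ≤ C * M ^ k / (k.factorial : ℝ) * (‖z‖ + 1) ^ k := by
        gcongr
        exact ha k
    _ = _ := by rw [mul_pow]; ring

lemma exists_entire_cos_sin : ∃ c s : ℂ → ℂ, Differentiable ℂ c ∧ Differentiable ℂ s ∧
    c 0 = 1 ∧ s 0 = 1 ∧ ∀ z, Complex.cos z = c (z ^ 2) ∧ Complex.sin z = z * s (z ^ 2) := by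
  refine ⟨fun z => ∑' k : ℕ, ((-1) ^ k / ((2 * k).factorial : ℂ)) * z ^ k,
    fun z => ∑' k : ℕ, ((-1) ^ k / ((2 * k + 1).factorial : ℂ)) * z ^ k,
    differentiable_tsum_mul_pow (C := 1) (M := 1) fun k => ?_,
    differentiable_tsum_mul_pow (C := 1) (M := 1) fun k => ?_, ?_, ?_, fun z => ⟨?_, ?_⟩⟩
  · simp only [norm_div, norm_pow, norm_neg, norm_one, one_pow, Complex.norm_natCast, mul_one]
    gcongr
    omega
  · simp only [norm_div, norm_pow, norm_neg, norm_one, one_pow, Complex.norm_natCast, mul_one]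
    gcongr
    omega
  · simp only
    rw [tsum_eq_single 0 (fun k hk => by simp [hk])]
    simp
  · simp only
    rw [tsum_eq_single 0 (fun k hk => by simp [hk])]
    simp
  · rw [Complex.cos_eq_tsum]
    exact tsum_congr fun k => by rw [← pow_mul]; ring
  · rw [Complex.sin_eq_tsum]
    simp only
    rw [← tsum_mul_left]
    exact tsum_congr fun k => by rw [← pow_mul]; ring

/-- `e^{ikv} = C(v²) + i v S(v²)` with `C` and `S` entire. -/
lemma exists_entire_phase (k : ℝ) : ∃ C S : ℂ → ℂ, Differentiable ℂ C ∧ Differentiable ℂ S ∧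
    C 0 = 1 ∧ S 0 = k ∧
    ∀ v : ℝ, phase k v = C ((v : ℂ) ^ 2) + Complex.I * v * S ((v : ℂ) ^ 2) := by
  obtain ⟨c, s, hc, hs, c0, s0, H⟩ := exists_entire_cos_sin
  refine ⟨fun z => c ((k : ℂ) ^ 2 * z), fun z => k * s ((k : ℂ) ^ 2 * z), by fun_prop,
    by fun_prop, by simp [c0], by simp [s0], fun v => ?_⟩
  obtain ⟨h1, h2⟩ := H (k * v)
  rw [mul_pow] at h1 h2
  rw [phase, show Complex.I * (k : ℂ) * (v : ℂ) = (k * v : ℂ) * Complex.I by ring,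
    Complex.exp_mul_I, h1, h2]
  ring

/-- Split each phase into parts even and odd in `v`. The even part of the `v⁻³` numerator is `C -
C'`, which vanishes at `0` as a function of `v²` and so leaves only `v⁻¹`. The `v⁻²` terms combine
into `(k C - S) - (k' C' - S')`, which also vanishes there because `C 0 = 1` and `S 0 = k`. -/
lemma exists_entire_phiThree (lam mu omega : ℝ) :
    (∃ P Q : ℂ → ℂ, Differentiable ℂ P ∧ Differentiable ℂ Q ∧ ∀ v : ℝ, 0 < v →
      phi1Three lam mu omega v = P ((v : ℂ) ^ 2) / v + Q ((v : ℂ) ^ 2)) ∧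
    (∃ P Q : ℂ → ℂ, Differentiable ℂ P ∧ Differentiable ℂ Q ∧ ∀ v : ℝ, 0 < v →
      phi2Three lam mu omega v = P ((v : ℂ) ^ 2) / v + Q ((v : ℂ) ^ 2)) := by
  obtain ⟨C, S, hC, hS, C0, S0, hs⟩ := exists_entire_phase (ks mu omega)
  obtain ⟨C', S', hC', hS', C0', S0', hp⟩ := exists_entire_phase (kp lam mu omega)
  unfold phi1Three phi2Three
  set k : ℂ := (ks mu omega : ℂ)
  set k' : ℂ := (kp lam mu omega : ℂ)
  obtain ⟨q, hq, Hq⟩ := exists_entire_mul (g := fun z => C z - C' z) (by fun_prop)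
    (by simp [C0, C0'])
  obtain ⟨p, hp', Hp⟩ := exists_entire_mul
    (g := fun z => (k * C z - S z) - (k' * C' z - S' z)) (by fun_prop) (by simp [C0, C0', S0, S0'])
  have Hq' : ∀ v : ℂ, v ≠ 0 → q (v ^ 2) = (C (v ^ 2) - C' (v ^ 2)) / v ^ 2 := fun v hv => by
    rw [Hq]; field_simp
  have Hp' : ∀ v : ℂ, v ≠ 0 → p (v ^ 2) =
      ((k * C (v ^ 2) - S (v ^ 2)) - (k' * C' (v ^ 2) - S' (v ^ 2))) / v ^ 2 := fun v hv => by
    rw [Hp]; field_simp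
  set a : ℂ := 1 / (4 * (Real.pi : ℂ) * (omega : ℂ) ^ 2) with ha
  constructor
  · refine ⟨fun z => a * (k ^ 2 * C z - (k * S z - k' * S' z) - q z),
      fun z => a * Complex.I * (k ^ 2 * S z + p z), by fun_prop, by fun_prop, fun v hv => ?_⟩
    have v0 : (v : ℂ) ≠ 0 := Complex.ofReal_ne_zero.2 hv.ne'
    simp only [hs, hp, Hq' _ v0, Hp' _ v0]
    rw [show k ^ 2 / (4 * (Real.pi : ℂ) * (omega : ℂ) ^ 2) = k ^ 2 * a by
      rw [ha]; ring]
    clear_value a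
    field_simp
    ring_nf
    simp only [Complex.I_sq]
    ring
  · refine ⟨fun z => a * (-(k ^ 2 * C z - k' ^ 2 * C' z) + 3 * (k * S z - k' * S' z) + 3 * q z),
      fun z => a * Complex.I * (-(k ^ 2 * S z - k' ^ 2 * S' z) - 3 * p z),
      by fun_prop, by fun_prop, fun v hv => ?_⟩
    have v0 : (v : ℂ) ≠ 0 := Complex.ofReal_ne_zero.2 hv.ne'
    simp only [hs, hp, Hq' _ v0, Hp' _ v0]
    clear_value a
    field_simp
    ring_nf
    simp only [Complex.I_sq]
    ring

lemma harmonic_le_natCast (m : ℕ) : harmonic m ≤ m := by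
  induction m with
  | zero => simp
  | succ m ih =>
    rw [harmonic_succ]
    have : ((m + 1 : ℕ) : ℚ)⁻¹ ≤ 1 := inv_le_one_of_one_le₀ (by simp)
    push_cast at this ⊢
    linarith

lemma harmonic_nonneg (m : ℕ) : 0 ≤ harmonic m :=
  Finset.sum_nonneg fun _ _ => by positivity

/-- The power series of `J_n`, up to a power, as a function of the squared half-argument. -/
lemma exists_entire_besselJ (n : ℕ) : ∃ j : ℂ → ℂ, Differentiable ℂ j ∧
    j 0 = 1 / (n.factorial : ℂ) ∧
    ∀ v : ℝ, (besselJ n v : ℂ) = ((v : ℂ) / 2) ^ n * j (((v : ℂ) / 2) ^ 2) := by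
  refine ⟨fun z => ∑' k : ℕ, ((-1) ^ k / ((k.factorial : ℂ) * ((n + k).factorial : ℂ))) * z ^ k,
    differentiable_tsum_mul_pow (C := 1) (M := 1) fun k => ?_, ?_, fun v => ?_⟩
  · simp only [norm_div, norm_pow, norm_neg, norm_one, one_pow, norm_mul, Complex.norm_natCast,
      mul_one]
    gcongr
    exact le_mul_of_one_le_right (by positivity) (by exact_mod_cast (Nat.factorial_pos _))
  · simp only
    rw [tsum_eq_single 0 (fun k hk => by simp [hk])]
    simp
  · rw [besselJ, Complex.ofReal_tsum, ← tsum_mul_left]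
    exact tsum_congr fun k => by push_cast; rw [← pow_mul, pow_add]; ring

/-- The second power series in the expansion of `Y_n`. -/
lemma exists_entire_besselY (n : ℕ) : ∃ y : ℂ → ℂ, Differentiable ℂ y ∧
    ∀ v : ℝ, ((∑' k : ℕ, ((harmonic k : ℝ) + (harmonic (n + k) : ℝ)
        - 2 * Real.eulerMascheroniConstant)
          * ((-1 : ℝ) ^ k / ((k.factorial : ℝ) * ((n + k).factorial : ℝ)))
          * (v / 2) ^ (2 * k + n) : ℝ) : ℂ) = ((v : ℂ) / 2) ^ n * y (((v : ℂ) / 2) ^ 2) := by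
  refine ⟨fun z => ∑' k : ℕ, ((((harmonic k : ℝ) + (harmonic (n + k) : ℝ)
      - 2 * Real.eulerMascheroniConstant : ℝ) : ℂ)
      * ((-1) ^ k / ((k.factorial : ℂ) * ((n + k).factorial : ℂ)))) * z ^ k,
    -- `M = 2` because the harmonic numbers are bounded through `harmonic k ≤ k ≤ 2 ^ k`.
    differentiable_tsum_mul_pow (C := n + 2 + 2 * |Real.eulerMascheroniConstant|) (M := 2)
      fun k => ?_, fun v => ?_⟩
  · rw [norm_mul, Complex.norm_real]
    have h1 : ‖((-1) ^ k / ((k.factorial : ℂ) * ((n + k).factorial : ℂ)))‖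
        ≤ 1 / (k.factorial : ℝ) := by
      simp only [norm_div, norm_pow, norm_neg, norm_one, one_pow, norm_mul, Complex.norm_natCast]
      gcongr
      exact le_mul_of_one_le_right (by positivity) (by exact_mod_cast (Nat.factorial_pos _))
    have h2 : ‖(harmonic k : ℝ) + (harmonic (n + k) : ℝ) - 2 * Real.eulerMascheroniConstant‖
        ≤ (n + 2 + 2 * |Real.eulerMascheroniConstant|) * 2 ^ k := by
      have a1 : (harmonic k : ℝ) ≤ k := by exact_mod_cast harmonic_le_natCast k
      have a2 : (harmonic (n + k) : ℝ) ≤ n + k := by exact_mod_cast harmonic_le_natCast (n + k)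
      have a3 : (0 : ℝ) ≤ harmonic k := by exact_mod_cast harmonic_nonneg k
      have a4 : (0 : ℝ) ≤ harmonic (n + k) := by exact_mod_cast harmonic_nonneg (n + k)
      have a5 : (k : ℝ) ≤ 2 ^ k := by exact_mod_cast Nat.lt_two_pow_self.le
      have a6 : (1 : ℝ) ≤ 2 ^ k := one_le_pow₀ one_le_two
      have a7 := neg_abs_le Real.eulerMascheroniConstant
      have a8 := le_abs_self Real.eulerMascheroniConstant
      have b : (n : ℝ) + 2 * |Real.eulerMascheroniConstant| ≤
          (n + 2 * |Real.eulerMascheroniConstant|) * 2 ^ k :=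
        le_mul_of_one_le_right (by positivity) a6
      rw [norm_eq_abs, abs_le]
      constructor <;> nlinarith
    calc _ ≤ (n + 2 + 2 * |Real.eulerMascheroniConstant|) * 2 ^ k * (1 / (k.factorial : ℝ)) := by
          gcongr
      _ = _ := by ring
  · rw [Complex.ofReal_tsum, ← tsum_mul_left]
    exact tsum_congr fun k => by push_cast; rw [← pow_mul, pow_add]; ring

lemma exists_entire_hankel1_zero {k : ℝ} (hk : 0 < k) : ∃ A B : ℂ → ℂ, Differentiable ℂ A ∧
    Differentiable ℂ B ∧ A 0 = 2 * Complex.I / (Real.pi : ℂ) ∧ ∀ v : ℝ, 0 < v →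
    hankel1 0 (k * v) = (Real.log v : ℂ) * A ((v : ℂ) ^ 2) + B ((v : ℂ) ^ 2) := by
  obtain ⟨j, hj, j0, J⟩ := exists_entire_besselJ 0
  obtain ⟨y, hy, Y⟩ := exists_entire_besselY 0
  refine ⟨fun z => 2 * Complex.I / (Real.pi : ℂ) * j ((k : ℂ) ^ 2 / 4 * z),
    fun z => j ((k : ℂ) ^ 2 / 4 * z) + Complex.I * (2 / (Real.pi : ℂ) * (Real.log (k / 2) : ℂ)
      * j ((k : ℂ) ^ 2 / 4 * z) - 1 / (Real.pi : ℂ) * y ((k : ℂ) ^ 2 / 4 * z)),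
    by fun_prop, by fun_prop, by simp [j0], fun v hv => ?_⟩
  have hlog : Real.log (k * v / 2) = Real.log v + Real.log (k / 2) := by
    rw [← Real.log_mul hv.ne' (by positivity)]; ring_nf
  have harg : ((k * v : ℝ) / 2 : ℂ) ^ 2 = (k : ℂ) ^ 2 / 4 * (v : ℂ) ^ 2 := by push_cast; ring
  rw [hankel1, besselY]
  simp only [Complex.ofReal_sub, Complex.ofReal_mul (2 / Real.pi * _),
    Complex.ofReal_mul (1 / Real.pi), Y, J, harg, hlog, Finset.range_zero, Finset.sum_empty]
  push_cast
  ring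

/-- In this form the singular part of `(k / v) * hankel1 1 (k * v)` is `-2i / (π v²)` plus a
logarithm; the pole does not depend on `k`, so it cancels between the two wave numbers. -/
lemma exists_entire_hankel1_one {k : ℝ} (hk : 0 < k) : ∃ A B : ℂ → ℂ, Differentiable ℂ A ∧
    Differentiable ℂ B ∧ A 0 = Complex.I * (k : ℂ) ^ 2 / (Real.pi : ℂ) ∧ ∀ v : ℝ, 0 < v →
    hankel1 1 (k * v) = (v : ℂ) / k * ((Real.log v : ℂ) * A ((v : ℂ) ^ 2) + B ((v : ℂ) ^ 2)
      - 2 * Complex.I / ((Real.pi : ℂ) * (v : ℂ) ^ 2)) := by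
  obtain ⟨j, hj, j0, J⟩ := exists_entire_besselJ 1
  obtain ⟨y, hy, Y⟩ := exists_entire_besselY 1
  refine ⟨fun z => Complex.I * (k : ℂ) ^ 2 / (Real.pi : ℂ) * j ((k : ℂ) ^ 2 / 4 * z),
    fun z => (k : ℂ) ^ 2 / 2 * (j ((k : ℂ) ^ 2 / 4 * z) + Complex.I * (2 / (Real.pi : ℂ)
      * (Real.log (k / 2) : ℂ) * j ((k : ℂ) ^ 2 / 4 * z)
      - 1 / (Real.pi : ℂ) * y ((k : ℂ) ^ 2 / 4 * z))),
    by fun_prop, by fun_prop, by simp [j0], fun v hv => ?_⟩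
  have hlog : Real.log (k * v / 2) = Real.log v + Real.log (k / 2) := by
    rw [← Real.log_mul hv.ne' (by positivity)]; ring_nf
  have harg : ((k * v : ℝ) / 2 : ℂ) ^ 2 = (k : ℂ) ^ 2 / 4 * (v : ℂ) ^ 2 := by push_cast; ring
  have v0 : (v : ℂ) ≠ 0 := Complex.ofReal_ne_zero.2 hv.ne'
  have k0 : (k : ℂ) ≠ 0 := Complex.ofReal_ne_zero.2 hk.ne'
  have p0 : (Real.pi : ℂ) ≠ 0 := Complex.ofReal_ne_zero.2 Real.pi_ne_zero
  rw [hankel1, besselY]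
  simp only [Complex.ofReal_sub, Complex.ofReal_mul (2 / Real.pi * _),
    Complex.ofReal_mul (1 / Real.pi), Y, J, harg, hlog, Finset.range_one, Finset.sum_singleton]
  simp only [Nat.sub_self, Nat.factorial_zero, Nat.cast_zero, Nat.cast_one, mul_zero, zero_sub,
    zpow_neg, zpow_one, pow_one]
  push_cast
  field_simp
  ring

lemma exists_entire_phiTwo {lam mu omega : ℝ} (hmu : 0 < mu) (hlam : 0 < 2 * mu + lam)
    (homega : 0 < omega) :
    (∃ P Q : ℂ → ℂ, Differentiable ℂ P ∧ Differentiable ℂ Q ∧ ∀ v : ℝ, 0 < v →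
      phi1Two lam mu omega v = P ((v : ℂ) ^ 2) * (Real.log v : ℂ) + Q ((v : ℂ) ^ 2)) ∧
    (∃ P Q : ℂ → ℂ, Differentiable ℂ P ∧ Differentiable ℂ Q ∧ ∀ v : ℝ, 0 < v →
      phi2Two lam mu omega v =
        (v : ℂ) ^ 2 * P ((v : ℂ) ^ 2) * (Real.log v : ℂ) + Q ((v : ℂ) ^ 2)) := by
  have hks : 0 < ks mu omega := div_pos homega (Real.sqrt_pos.2 hmu)
  have hkp : 0 < kp lam mu omega := div_pos homega (Real.sqrt_pos.2 hlam)
  obtain ⟨A, B, hA, hB, A0, H0⟩ := exists_entire_hankel1_zero hks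
  obtain ⟨A', B', hA', hB', A0', H0'⟩ := exists_entire_hankel1_zero hkp
  obtain ⟨C, D, hC, hD, C0, H1⟩ := exists_entire_hankel1_one hks
  obtain ⟨C', D', hC', hD', C0', H1'⟩ := exists_entire_hankel1_one hkp
  have k0 : (ks mu omega : ℂ) ≠ 0 := Complex.ofReal_ne_zero.2 hks.ne'
  have k0' : (kp lam mu omega : ℂ) ≠ 0 := Complex.ofReal_ne_zero.2 hkp.ne'
  have p0 : (Real.pi : ℂ) ≠ 0 := Complex.ofReal_ne_zero.2 Real.pi_ne_zero
  have w0 : (omega : ℂ) ≠ 0 := Complex.ofReal_ne_zero.2 homega.ne'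
  have m0 : (mu : ℂ) ≠ 0 := Complex.ofReal_ne_zero.2 hmu.ne'
  unfold phi1Two phi2Two
  constructor
  · refine ⟨fun z => Complex.I / (4 * (mu : ℂ)) * A z
        - Complex.I / (4 * (omega : ℂ) ^ 2) * (C z - C' z),
      fun z => Complex.I / (4 * (mu : ℂ)) * B z
        - Complex.I / (4 * (omega : ℂ) ^ 2) * (D z - D' z), by fun_prop, by fun_prop,
      fun v hv => ?_⟩
    have v0 : (v : ℂ) ≠ 0 := Complex.ofReal_ne_zero.2 hv.ne'
    rw [H0 v hv, H1 v hv, H1' v hv]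
    field_simp
    ring
  -- The logarithmic coefficient vanishes at `0`, since `2 C 0 = k² A 0` for each wave number. The
  -- resulting factor `v²` is essential: it clears the denominator of `x_a x_b / |x|²`, whose
  -- product with `log |x|` would cost an extra logarithm in the differences.
  · obtain ⟨q, hq, Hq⟩ := exists_entire_mul (g := fun z => 2 * C z - (ks mu omega : ℂ) ^ 2 * A z
        - 2 * C' z + (kp lam mu omega : ℂ) ^ 2 * A' z) (by fun_prop)
      (by simp only [A0, A0', C0, C0']; ring)
    refine ⟨fun z => Complex.I / (4 * (omega : ℂ) ^ 2) * q z,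
      fun z => Complex.I / (4 * (omega : ℂ) ^ 2) * (2 * D z - (ks mu omega : ℂ) ^ 2 * B z
        - 2 * D' z + (kp lam mu omega : ℂ) ^ 2 * B' z), by fun_prop, by fun_prop,
      fun v hv => ?_⟩
    have v0 : (v : ℂ) ≠ 0 := Complex.ofReal_ne_zero.2 hv.ne'
    rw [H0 v hv, H0' v hv, H1 v hv, H1' v hv,
      mul_left_comm ((v : ℂ) ^ 2), ← Hq ((v : ℂ) ^ 2)]
    field_simp
    ring

end EntireExpansions
end LameKernel

namespace LameKernel

open Real

/-! ### The truncated tensor satisfies the kernel bounds -/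

section Kernel

/-- The norm fails to be smooth only at the origin, and there the cutoff is locally constant. -/
lemma contDiff_cutoff_norm {E : Type*} [NormedAddCommGroup E] [InnerProductSpace ℝ E]
    {ψ : ℝ → ℝ} {δ : ℝ} (hδ : 0 < δ) (hψ : ContDiffOn ℝ ∞ ψ (Set.Ici 0))
    (hψ_one : ∀ r : ℝ, 0 ≤ r → r ≤ δ → ψ r = 1) :
    ContDiff ℝ 2 (fun x : E => (ψ ‖x‖ : ℂ)) := by
  refine Complex.ofRealCLM.contDiff.comp (contDiff_iff_contDiffAt.2 fun x => ?_)
  by_cases hx : x = 0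
  · have : (fun x : E => ψ ‖x‖) =ᶠ[nhds x] fun _ => 1 := by
      filter_upwards [Metric.ball_mem_nhds x hδ] with y hy
      rw [hx, mem_ball_zero_iff] at hy
      exact hψ_one _ (norm_nonneg y) hy.le
    exact contDiffAt_const.congr_of_eventuallyEq this
  · have h1 : ContDiffAt ℝ 2 ψ ‖x‖ :=
      (hψ.contDiffAt (Ici_mem_nhds (norm_pos_iff.2 hx))).of_le ENat.LEInfty.out
    exact h1.comp x (contDiffAt_norm ℝ hx)

lemma contDiff_entire_norm_sq {E : Type*} [NormedAddCommGroup E] [InnerProductSpace ℝ E]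
    {P : ℂ → ℂ} (hP : Differentiable ℂ P) : ContDiff ℝ 2 (fun x : E => P ((‖x‖ : ℂ) ^ 2)) := by
  have h1 : ContDiff ℝ 2 P := (hP.contDiff (n := 2)).restrict_scalars ℝ
  have h2 : ContDiff ℝ 2 (fun x : E => ((‖x‖ ^ 2 : ℝ) : ℂ)) :=
    Complex.ofRealCLM.contDiff.comp (contDiff_norm_sq ℝ)
  simpa [Function.comp_def] using h1.comp h2

variable {d : ℕ}

lemma contDiff_coord (a : Fin d) :
    ContDiff ℝ 2 (fun x : EuclideanSpace ℝ (Fin d) => (x a : ℂ)) :=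
  Complex.ofRealCLM.contDiff.comp (by fun_prop)

lemma kernelBound_coord_mul_coord_div (m : ℕ) (D : ℝ) (a b : Fin d) :
    KernelBound m D (fun x : EuclideanSpace ℝ (Fin d) =>
      (x a : ℂ) * (x b : ℂ) / (‖x‖ : ℂ) ^ (m + 2)) := by
  refine KernelBound.of_homogeneous (fun x hx => ?_) fun r hr y hy => ?_
  · have hn : ContDiffAt ℝ 2 (fun x : EuclideanSpace ℝ (Fin d) => (‖x‖ : ℂ)) x :=
      Complex.ofRealCLM.contDiff.contDiffAt.comp x (contDiffAt_norm ℝ hx)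
    have x0 : (‖x‖ : ℂ) ^ (m + 2) ≠ 0 :=
      pow_ne_zero _ (Complex.ofReal_ne_zero.2 (norm_ne_zero_iff.2 hx))
    simp only [div_eq_mul_inv]
    exact (((contDiff_coord a).mul (contDiff_coord b)).contDiffAt.mul
      ((hn.pow (m + 2)).inv x0)).contDiffWithinAt
  · have r0 : (r : ℂ) ≠ 0 := Complex.ofReal_ne_zero.2 hr.ne'
    have y0 : (‖y‖ : ℂ) ≠ 0 := Complex.ofReal_ne_zero.2 (norm_ne_zero_iff.2 hy)
    rw [norm_smul, norm_of_nonneg hr.le]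
    simp only [PiLp.smul_apply, smul_eq_mul, Complex.ofReal_mul, mul_pow]
    field_simp
    ring

lemma kernelBound_inv_norm (D : ℝ) :
    KernelBound 1 D (fun x : EuclideanSpace ℝ (Fin d) => (‖x‖ : ℂ)⁻¹) := by
  refine KernelBound.of_homogeneous (fun x hx => ?_) fun r hr y hy => ?_
  · have hn : ContDiffAt ℝ 2 (fun x : EuclideanSpace ℝ (Fin d) => (‖x‖ : ℂ)) x :=
      Complex.ofRealCLM.contDiff.contDiffAt.comp x (contDiffAt_norm ℝ hx)
    exact (hn.inv (Complex.ofReal_ne_zero.2 (norm_ne_zero_iff.2 hx))).contDiffWithinAt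
  · rw [norm_smul, norm_of_nonneg hr.le]
    push_cast
    rw [mul_inv, pow_one, mul_comm, div_eq_mul_inv]

lemma K_apply (lam mu omega : ℝ) (ψ : ℝ → ℝ) (x : EuclideanSpace ℝ (Fin d)) (a b : Fin d) :
    K d lam mu omega ψ x a b = (ψ ‖x‖ : ℂ) * (phi1 d lam mu omega ‖x‖ * (if a = b then 1 else 0)
      + phi2 d lam mu omega ‖x‖ * ((x a : ℂ) * (x b : ℂ) / (‖x‖ : ℂ) ^ 2)) := by
  simp [K, Phi, matJ, Matrix.one_apply]

lemma kernelBound_K_two {lam mu omega : ℝ} (hmu : 0 < mu) (hlam : 0 < 2 * mu + lam)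
    (homega : 0 < omega) {ψ : ℝ → ℝ}
    (hψ : ContDiff ℝ 2 (fun x : EuclideanSpace ℝ (Fin 2) => (ψ ‖x‖ : ℂ))) (D : ℝ) (a b : Fin 2) :
    KernelBound 0 D (fun x => K 2 lam mu omega ψ x a b) := by
  obtain ⟨⟨P, Q, hP, hQ, H1⟩, P', Q', hP', hQ', H2⟩ := exists_entire_phiTwo hmu hlam homega
  have cP := contDiff_entire_norm_sq (E := EuclideanSpace ℝ (Fin 2)) hP
  have cQ := contDiff_entire_norm_sq (E := EuclideanSpace ℝ (Fin 2)) hQ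
  have cP' := contDiff_entire_norm_sq (E := EuclideanSpace ℝ (Fin 2)) hP'
  have cQ' := contDiff_entire_norm_sq (E := EuclideanSpace ℝ (Fin 2)) hQ'
  set δ : ℂ := if a = b then 1 else 0
  have t1 := (KernelBound.log_norm (D := D)).mul_contDiff
    (hψ.mul ((cP.mul (contDiff_const (c := δ))).add
      (((contDiff_coord a).mul (contDiff_coord b)).mul cP')))
  have t2 := KernelBound.of_contDiff (D := D) (hψ.mul (cQ.mul (contDiff_const (c := δ))))
  have t3 := (kernelBound_coord_mul_coord_div 0 D a b).mul_contDiff (hψ.mul cQ')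
  refine ((t1.add t2).add t3).congr fun x hx => ?_
  have x0 : (‖x‖ : ℂ) ≠ 0 := Complex.ofReal_ne_zero.2 (norm_ne_zero_iff.2 hx)
  rw [K_apply, phi1, phi2, if_pos rfl, if_pos rfl, H1 _ (norm_pos_iff.2 hx),
    H2 _ (norm_pos_iff.2 hx)]
  field_simp
  ring

lemma kernelBound_K_three (lam mu omega : ℝ) {ψ : ℝ → ℝ}
    (hψ : ContDiff ℝ 2 (fun x : EuclideanSpace ℝ (Fin 3) => (ψ ‖x‖ : ℂ))) (D : ℝ) (a b : Fin 3) :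
    KernelBound 1 D (fun x => K 3 lam mu omega ψ x a b) := by
  obtain ⟨⟨P, Q, hP, hQ, H1⟩, P', Q', hP', hQ', H2⟩ := exists_entire_phiThree lam mu omega
  have cP := contDiff_entire_norm_sq (E := EuclideanSpace ℝ (Fin 3)) hP
  have cQ := contDiff_entire_norm_sq (E := EuclideanSpace ℝ (Fin 3)) hQ
  have cP' := contDiff_entire_norm_sq (E := EuclideanSpace ℝ (Fin 3)) hP'
  have cQ' := contDiff_entire_norm_sq (E := EuclideanSpace ℝ (Fin 3)) hQ'
  set δ : ℂ := if a = b then 1 else 0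
  have t1 := (kernelBound_inv_norm D).mul_contDiff (hψ.mul (cP.mul (contDiff_const (c := δ))))
  have t2 := (KernelBound.of_contDiff (D := D)
    (hψ.mul (cQ.mul (contDiff_const (c := δ))))).succ
  have t3 := (kernelBound_coord_mul_coord_div 1 D a b).mul_contDiff (hψ.mul cP')
  have t4 := ((kernelBound_coord_mul_coord_div 0 D a b).mul_contDiff (hψ.mul cQ')).succ
  refine (((t1.add t2).add t3).add t4).congr fun x hx => ?_
  have x0 : (‖x‖ : ℂ) ≠ 0 := Complex.ofReal_ne_zero.2 (norm_ne_zero_iff.2 hx)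
  rw [K_apply, phi1, phi2, if_neg (show ¬3 = 2 by norm_num), if_neg (show ¬3 = 2 by norm_num),
    H1 _ (norm_pos_iff.2 hx), H2 _ (norm_pos_iff.2 hx)]
  field_simp
  ring

end Kernel

/-! ### From second differences to Fourier coefficients -/

section FourierCoefficients

open MeasureTheory

variable {d : ℕ} {R : ℝ}

lemma norm_expo (hR : 0 < R) (j : Fin d → ℤ) (x : EuclideanSpace ℝ (Fin d)) :
    ‖expo d R j x‖ = ((2 * R) ^ ((d : ℝ) / 2))⁻¹ := by
  have : Complex.I * (π : ℂ) * ((∑ k, (j k : ℝ) * x k : ℝ) : ℂ) / (R : ℂ) =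
      ((π * (∑ k, (j k : ℝ) * x k) / R : ℝ) : ℂ) * Complex.I := by push_cast; ring
  rw [expo, norm_div, this, Complex.norm_exp_ofReal_mul_I, Complex.norm_real,
    norm_of_nonneg (by positivity), one_div]

lemma continuous_expo (j : Fin d → ℤ) : Continuous (expo d R j) := by
  unfold expo
  fun_prop

/-- The shift raises `j · x` by exactly `R`, hence the phase by `π`. -/
lemma expo_add_single (hR : 0 < R) {j : Fin d → ℤ} {k : Fin d} (hk : j k ≠ 0)
    (x : EuclideanSpace ℝ (Fin d)) :
    expo d R j (x + EuclideanSpace.single k (R / (j k : ℝ))) = -expo d R j x := by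
  have hs : ∑ i, (j i : ℝ) * (x + EuclideanSpace.single k (R / (j k : ℝ))) i =
      (∑ i, (j i : ℝ) * x i) + R := by
    have hk' : (j k : ℝ) ≠ 0 := Int.cast_ne_zero.2 hk
    simp only [PiLp.add_apply, mul_add, Finset.sum_add_distrib]
    congr 1
    rw [Finset.sum_eq_single k]
    · simp; field_simp
    · intro i _ hi
      simp [hi]
    · simp
  have R0 : (R : ℂ) ≠ 0 := Complex.ofReal_ne_zero.2 hR.ne'
  have : Complex.I * (π : ℂ) * (((∑ i, (j i : ℝ) * x i) + R : ℝ) : ℂ) / (R : ℂ) =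
      Complex.I * (π : ℂ) * ((∑ i, (j i : ℝ) * x i : ℝ) : ℂ) / (R : ℂ) + π * Complex.I := by
    push_cast; field_simp
  rw [expo, hs, this, Complex.exp_add, Complex.exp_pi_mul_I, expo]
  ring

/-- The ball of radius `R` lies inside the cube, so no periodization is needed and translations act
on an integral over the whole space. -/
lemma fourierCoef_eq_integral {u : EuclideanSpace ℝ (Fin d) → ℂ}
    (h0 : ∀ x, R ≤ ‖x‖ → u x = 0) (j : Fin d → ℤ) :
    fourierCoef d R u j = ∫ x, u x * (starRingEnd ℂ) (expo d R j x) := by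
  refine setIntegral_eq_integral_of_forall_compl_eq_zero fun x hx => ?_
  rw [h0 x, zero_mul]
  by_contra! h
  exact hx fun k => by simpa using (PiLp.norm_apply_le x k).trans_lt h

/-- Shifting by half a period of `φ_j` in one coordinate bounds a Fourier coefficient by a second
difference. -/
lemma four_mul_norm_fourierCoef_le (hR : 0 < R) {u : EuclideanSpace ℝ (Fin d) → ℂ}
    (hu : Integrable u) (h0 : ∀ x, R ≤ ‖x‖ → u x = 0) {j : Fin d → ℤ} {k : Fin d}
    (hk : j k ≠ 0) :
    4 * ‖fourierCoef d R u j‖ ≤ ((2 * R) ^ ((d : ℝ) / 2))⁻¹ *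
      ∫ x, ‖u (x + EuclideanSpace.single k (R / (j k : ℝ)))
        + u (x - EuclideanSpace.single k (R / (j k : ℝ))) - 2 * u x‖ := by
  rw [fourierCoef_eq_integral h0]
  set h := EuclideanSpace.single k (R / (j k : ℝ)) with hh
  set e : EuclideanSpace ℝ (Fin d) → ℂ := fun x => (starRingEnd ℂ) (expo d R j x) with he
  have ep : ∀ x, e (x + h) = -e x := fun x => by
    simp only [he, hh, expo_add_single hR hk, map_neg]
  have em : ∀ x, e (x - h) = -e x := fun x => by
    rw [← neg_eq_iff_eq_neg, ← ep, sub_add_cancel]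
  have ne : ∀ x, ‖e x‖ = ((2 * R) ^ ((d : ℝ) / 2))⁻¹ := fun x => by
    simp only [he, RCLike.norm_conj, norm_expo hR]
  have ec : Continuous e := Complex.continuous_conj.comp (continuous_expo j)
  have int : ∀ {v : EuclideanSpace ℝ (Fin d) → ℂ}, Integrable v →
      Integrable fun x => v x * e x := fun hv =>
    hv.mul_bdd (c := ((2 * R) ^ ((d : ℝ) / 2))⁻¹) ec.aestronglyMeasurable
      (Filter.Eventually.of_forall fun x => (ne x).le)
  have i1 := int (hu.comp_add_right h)
  have i2 := int (hu.comp_sub_right h)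
  have i3 := int (hu.const_mul 2)
  have s1 : ∫ x, u (x + h) * e x = -∫ x, u x * e x := by
    rw [← integral_sub_right_eq_self (fun x => u (x + h) * e x) h, ← integral_neg]
    exact integral_congr_ae (Filter.Eventually.of_forall fun x => by
      simp only [sub_add_cancel, em, mul_neg])
  have s2 : ∫ x, u (x - h) * e x = -∫ x, u x * e x := by
    rw [← integral_add_right_eq_self (fun x => u (x - h) * e x) h, ← integral_neg]
    exact integral_congr_ae (Filter.Eventually.of_forall fun x => by
      simp only [add_sub_cancel_right, ep, mul_neg])
  have s3 : ∫ x, 2 * u x * e x = 2 * ∫ x, u x * e x := by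
    simp only [mul_assoc, integral_const_mul]
  have key : ∫ x, (u (x + h) + u (x - h) - 2 * u x) * e x = -(4 * ∫ x, u x * e x) := by
    simp only [sub_mul, add_mul]
    rw [integral_sub (f := fun x => u (x + h) * e x + u (x - h) * e x) (i1.add i2) i3,
      integral_add i1 i2, s1, s2, s3]
    ring
  calc 4 * ‖∫ x, u x * e x‖ = ‖∫ x, (u (x + h) + u (x - h) - 2 * u x) * e x‖ := by
        rw [key, norm_neg, norm_mul, Complex.norm_ofNat]
    _ ≤ ∫ x, ‖(u (x + h) + u (x - h) - 2 * u x) * e x‖ := norm_integral_le_integral_norm _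
    _ = _ := by
        simp only [norm_mul, ne]
        rw [integral_mul_const, mul_comm]

/-- Take the coordinate of largest modulus: shifting along it gives an increment comparable to `1 /
|j|`. -/
lemma exists_coord_bounds (hd : 0 < d) (j : Fin d → ℤ) :
    ∃ k, |(j k : ℝ)| ≤ idxNorm d j ∧ idxNorm d j ^ 2 ≤ d * |(j k : ℝ)| ^ 2 := by
  have : Nonempty (Fin d) := ⟨⟨0, hd⟩⟩
  obtain ⟨k, hk⟩ := Finite.exists_max fun k => |(j k : ℝ)|
  refine ⟨k, ?_, ?_⟩
  · rw [idxNorm]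
    refine le_sqrt_of_sq_le ?_
    rw [sq_abs]
    exact Finset.single_le_sum (f := fun i => (j i : ℝ) ^ 2) (fun i _ => sq_nonneg _)
      (Finset.mem_univ k)
  · rw [idxNorm, sq_sqrt (Finset.sum_nonneg fun i _ => sq_nonneg _)]
    have := Finset.sum_le_card_nsmul Finset.univ (fun i => (j i : ℝ) ^ 2) (|(j k : ℝ)| ^ 2)
      fun i _ => by rw [← sq_abs]; exact pow_le_pow_left₀ (abs_nonneg _) (hk i) 2
    simpa using this

lemma KernelBound.exists_norm_fourierCoef_le {n : ℕ} (hR : 0 < R)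
    {u : EuclideanSpace ℝ (Fin (n + 2)) → ℂ} (hu : KernelBound n (3 * R) u)
    (h0 : ∀ x, R ≤ ‖x‖ → u x = 0) :
    ∃ c, 0 ≤ c ∧ ∀ j : Fin (n + 2) → ℤ, 1 ≤ idxNorm (n + 2) j →
      ‖fourierCoef (n + 2) R u j‖ ≤
        c * ((1 + log (idxNorm (n + 2) j)) / idxNorm (n + 2) j ^ 2) := by
  have hdim : Module.finrank ℝ (EuclideanSpace ℝ (Fin (n + 2))) = n + 2 := by simp
  obtain ⟨C, hC, H⟩ := hu.integral_second_difference_le volume hR hdim h0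
  have hint : Integrable u := hu.integrable volume hdim (by positivity)
    fun x hx => h0 x (by linarith)
  set N := ((2 * R) ^ (((n + 2 : ℕ) : ℝ) / 2))⁻¹ with hN
  have N0 : 0 ≤ N := by positivity
  refine ⟨N * C * (n + 2 : ℕ), by positivity, fun j hj => ?_⟩
  obtain ⟨k, hk1, hk2⟩ := exists_coord_bounds (by omega) j
  set J := idxNorm (n + 2) j
  have jk : j k ≠ 0 := by
    intro h
    rw [h] at hk2
    norm_num at hk2
    nlinarith
  set m := |(j k : ℝ)| with hm
  have m1 : 1 ≤ m := by
    have := Int.one_le_abs jk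
    rw [hm]
    exact_mod_cast this
  have b1 := four_mul_norm_fourierCoef_le hR hint h0 jk
  have b2 := H (EuclideanSpace.single k (R / (j k : ℝ))) m m1 (by
    rw [PiLp.norm_single, norm_div, norm_of_nonneg hR.le, norm_eq_abs])
  have lJ : 0 ≤ log J := log_nonneg hj
  have b3 : (1 + log m) / m ^ 2 ≤ (n + 2 : ℕ) * ((1 + log J) / J ^ 2) := by
    rw [← mul_div_assoc, div_le_div_iff₀ (by positivity) (by positivity)]
    calc (1 + log m) * J ^ 2 ≤ (1 + log J) * ((n + 2 : ℕ) * m ^ 2) := by gcongr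
      _ = _ := by ring
  calc ‖fourierCoef (n + 2) R u j‖ ≤ 4 * ‖fourierCoef (n + 2) R u j‖ := by
        linarith [norm_nonneg (fourierCoef (n + 2) R u j)]
    _ ≤ N * (C * ((n + 2 : ℕ) * ((1 + log J) / J ^ 2))) :=
        b1.trans (mul_le_mul_of_nonneg_left (b2.trans (by gcongr)) N0)
    _ = _ := by ring

lemma two_le_idxNorm_sq {j : Fin d → ℤ} (hj : 1 < idxNorm d j) : 2 ≤ idxNorm d j ^ 2 := by
  have e : idxNorm d j ^ 2 = ((∑ k, j k ^ 2 : ℤ) : ℝ) := by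
    rw [idxNorm, sq_sqrt (Finset.sum_nonneg fun i _ => sq_nonneg _)]
    push_cast
    rfl
  have h1 : (1 : ℝ) < idxNorm d j ^ 2 := one_lt_pow₀ hj two_ne_zero
  rw [e] at h1 ⊢
  have : (1 : ℤ) < ∑ k, j k ^ 2 := by exact_mod_cast h1
  exact_mod_cast (by omega : (2 : ℤ) ≤ ∑ k, j k ^ 2)

/-- As `|j|²` is an integer, `|j| > 1` forces `|j|² ≥ 2`, so `log |j| ≥ (log 2) / 2 > 1/3`. This
lets `1 + log |j|` be replaced by `4 log |j|`. -/
lemma one_le_three_mul_log_idxNorm {j : Fin d → ℤ} (hj : 1 < idxNorm d j) :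
    1 ≤ 3 * log (idxNorm d j) := by
  have h1 := log_le_log two_pos (two_le_idxNorm_sq hj)
  rw [log_pow] at h1
  have := log_two_gt_d9
  push_cast at h1
  linarith

lemma KernelBound.exists_fourierCoef_bounds {n : ℕ} (hR : 0 < R)
    {u : EuclideanSpace ℝ (Fin (n + 2)) → Matrix (Fin (n + 2)) (Fin (n + 2)) ℂ}
    (hu : ∀ a b, KernelBound n (3 * R) fun x => u x a b)
    (h0 : ∀ x, R ≤ ‖x‖ → u x = 0) :
    ∃ c : ℝ, 0 < c ∧ ∀ a b : Fin (n + 2),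
      IntegrableOn (fun x => u x a b) (cell (n + 2) R) ∧
      (∀ j : Fin (n + 2) → ℤ, 1 < idxNorm (n + 2) j →
        ‖fourierCoef (n + 2) R (fun x => u x a b) j‖
          ≤ c * (idxNorm (n + 2) j ^ (-2 : ℤ) * log (idxNorm (n + 2) j))) ∧
      (∀ j : Fin (n + 2) → ℤ, idxNorm (n + 2) j = 1 →
        ‖fourierCoef (n + 2) R (fun x => u x a b) j‖ ≤ c) := by
  have h0' : ∀ a b x, R ≤ ‖x‖ → u x a b = 0 := fun a b x hx => by simp [h0 x hx]
  choose c hc H using fun a b => (hu a b).exists_norm_fourierCoef_le hR (h0' a b)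
  have hle : ∀ a b, c a b ≤ ∑ a, ∑ b, c a b := fun a b =>
    (Finset.single_le_sum (f := fun b => c a b) (fun b _ => hc a b) (Finset.mem_univ b)).trans
      (Finset.single_le_sum (f := fun a => ∑ b, c a b)
        (fun a _ => Finset.sum_nonneg fun b _ => hc a b) (Finset.mem_univ a))
  set S := ∑ a, ∑ b, c a b
  have S0 : 0 ≤ S := (hc 0 0).trans (hle 0 0)
  -- The `4` comes from `1 + log |j| ≤ 4 log |j|`; the `1` only secures strict positivity.
  refine ⟨4 * S + 1, by positivity, fun a b => ⟨?_, fun j hj => ?_, fun j hj => ?_⟩⟩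
  · exact ((hu a b).integrable volume (by simp) (by positivity)
      fun x hx => h0' a b x (by linarith)).integrableOn
  · have l := one_le_three_mul_log_idxNorm hj
    refine (H a b j hj.le).trans ?_
    have hJ : 0 < idxNorm (n + 2) j := by linarith
    calc c a b * ((1 + log (idxNorm (n + 2) j)) / idxNorm (n + 2) j ^ 2)
        ≤ S * ((4 * log (idxNorm (n + 2) j)) / idxNorm (n + 2) j ^ 2) := by
          gcongr
          · exact div_nonneg (by linarith) (by positivity)
          · exact hle a b
          · linarith
      _ = 4 * S * (idxNorm (n + 2) j ^ (-2 : ℤ) * log (idxNorm (n + 2) j)) := by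
          rw [zpow_neg, zpow_ofNat]; ring
      _ ≤ _ := by
          refine mul_le_mul_of_nonneg_right (by linarith) (mul_nonneg (by positivity) ?_)
          linarith
  · have := H a b j hj.ge
    rw [hj] at this
    norm_num at this
    linarith [hle a b]

end FourierCoefficients

end LameKernel


theorem lemma5p2 (d : ℕ) (hd : d = 2 ∨ d = 3)
    (lam mu omega rho R : ℝ)
    (hmu : 0 < mu) (hlam : 0 < 2 * mu + lam) (homega : 0 < omega)
    (hrho : 0 < rho) (hR : 2 * rho < R)
    (ψ : ℝ → ℝ) (hψ : ContDiffOn ℝ ∞ ψ (Set.Ici 0))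
    (hψ_one : ∀ r : ℝ, 0 ≤ r → r ≤ 2 * rho → ψ r = 1)
    (hψ_zero : ∀ r : ℝ, R ≤ r → ψ r = 0) :
    ∃ c : ℝ, 0 < c ∧ ∀ a b : Fin d,
      MeasureTheory.IntegrableOn (fun x => LameKernel.K d lam mu omega ψ x a b)
        (LameKernel.cell d R) ∧
      (∀ j : Fin d → ℤ, 1 < LameKernel.idxNorm d j →
        ‖LameKernel.fourierCoef d R (fun x => LameKernel.K d lam mu omega ψ x a b) j‖
          ≤ c * (LameKernel.idxNorm d j ^ (-2 : ℤ) * Real.log (LameKernel.idxNorm d j))) ∧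
      (∀ j : Fin d → ℤ, LameKernel.idxNorm d j = 1 →
        ‖LameKernel.fourierCoef d R (fun x => LameKernel.K d lam mu omega ψ x a b) j‖ ≤ c) := by
  have hδ : 0 < 2 * rho := by positivity
  have hR0 : 0 < R := hδ.trans hR
  have h0 : ∀ x : EuclideanSpace ℝ (Fin d), R ≤ ‖x‖ → LameKernel.K d lam mu omega ψ x = 0 :=
    fun x hx => by simp [LameKernel.K, hψ_zero _ hx]
  obtain rfl | rfl := hd
  · exact LameKernel.KernelBound.exists_fourierCoef_bounds (n := 0) hR0 (fun a b =>
      LameKernel.kernelBound_K_two hmu hlam homega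
        (LameKernel.contDiff_cutoff_norm hδ hψ hψ_one) _ a b) h0
  · exact LameKernel.KernelBound.exists_fourierCoef_bounds (n := 1) hR0 (fun a b =>
      LameKernel.kernelBound_K_three lam mu omega
        (LameKernel.contDiff_cutoff_norm hδ hψ hψ_one) _ a b) h0
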